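/- Let $\mathcal{A}_3=\mathbb{Z}[x]/(x^3)$, graded by $\deg x=1$. For a finite simple graph $G$ with ordered edge set $E$, the chromatic graph cohomology $H^{i,j}_{\mathcal{A}_3}(G)$ is the cohomology in homological degree $i$ and internal degree $j$ of the complex $$C^i(G)=\bigoplus_{s\subset E,\ |s|=i}\mathcal{A}_3^{\otimes k(s)},\qquad d^i=\sum_{e\notin s}(-1)^{t(s,e)}d_e ,$$ where tensor products are over $\mathbb{Z}$, the tensor factors are indexed by the $k(s)$ connected components of the spanning subgraph $[G:s]$ with edge set $s$, $t(s,e)$ is the number of edges of $s$ that precede $e$, and $d_e:\mathcal{A}_3^{\otimes k(s)}\to\mathcal{A}_3^{\otimes k(s\cup e)}$ multiplies the factors of the two components joined by $e$ (and is the identity if both ends of $e$ lie in the same component). The internal degree of a tensor of homogeneous elements is the sum of their degrees. For $n\ge 4$ let $W_n$ be the wheel with $n$ vertices, that is, the cone over the $(n-1)$-gon. Then, for every ordering of the edges, $$H^{1,2n-3}_{\mathcal{A}_3}(W_n)\cong\begin{cases}\mathbb{Z}_3^{\,n-2}\oplus\mathbb{Z}^{n} & \text{if } n \text{ is odd},\\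 \mathbb{Z}_3^{\,n-1}\oplus\mathbb{Z}_2\oplus\mathbb{Z}^{n-1} & \text{if } n\ge 6 \text{ is even},\\ \mathbb{Z}_3^{3}\oplus\mathbb{Z}_2\oplus\mathbb{Z}^{2} & \text{if } n=4.\end{cases}$$ -/

import Mathlib

open scoped TensorProduct

namespace ChromaticCohomology

noncomputable section

/-! ### Tensor powers of a commutative algebra -/

section TensorPower

variable (R : Type*) [CommRing R] (A : Type*) [CommRing A] [Algebra R A]

open Classical in
/-- For a map `f : ι → κ` of finite sets, the linear map `A^{⊗ι} → A^{⊗κ}` that multiplies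
together all the tensor factors that are sent to the same element of `κ`:
`⊗_i a_i ↦ ⊗_k ∏_{f i = k} a_i`, see `mergeMap_tprod`. It is written as
`⊗_i a_i ↦ ∏_i (1 ⊗ ⋯ ⊗ a_i ⊗ ⋯ ⊗ 1)`, with `a_i` in position `f i`. -/
def mergeMap {ι κ : Type*} [Fintype ι] (f : ι → κ) :
    (⨂[R] _ : ι, A) →ₗ[R] (⨂[R] _ : κ, A) :=
  PiTensorProduct.lift
    ((MultilinearMap.mkPiAlgebra R ι (⨂[R] _ : κ, A)).compLinearMap fun i =>
      (PiTensorProduct.singleAlgHom (R := R) (A := fun _ : κ => A) (f i)).toLinearMap)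

open Classical in
theorem mergeMap_tprod {ι κ : Type*} [Fintype ι] (f : ι → κ) (a : ι → A) :
    mergeMap R A f (PiTensorProduct.tprod R a) =
      PiTensorProduct.tprod R (fun k => ∏ i with f i = k, a i) := by
  simp only [mergeMap, PiTensorProduct.lift.tprod, MultilinearMap.compLinearMap_apply,
    MultilinearMap.mkPiAlgebra_apply, AlgHom.toLinearMap_apply,
    PiTensorProduct.singleAlgHom_apply]
  rw [← PiTensorProduct.tprod_prod]
  congr 1
  funext k
  simp [Finset.prod_apply, Finset.prod_filter, Pi.mulSingle_apply, eq_comm]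

variable {A}

/-- If `A` is graded by the submodules `gr k`, this is the homogeneous part of degree `j` of the
tensor power `A^{⊗ι}`: it is spanned by the tensors `⊗ a_i` of homogeneous elements whose degrees
add up to `j`. -/
def tensorDegree (gr : ℕ → Submodule R A) (ι : Type*) [Fintype ι] (j : ℕ) :
    Submodule R (⨂[R] _ : ι, A) :=
  Submodule.span R {t | ∃ (w : ι → ℕ) (a : ι → A),
    (∀ i, a i ∈ gr (w i)) ∧ ∑ i, w i = j ∧ PiTensorProduct.tprod R a = t}

end TensorPower

/-! ### The chromatic cochain complex of a finite simple graph -/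

section Graph

variable {V : Type*} (G : SimpleGraph V)

/-- The spanning subgraph `[G : s]`: all vertices of `G`, and the edges in `s`. -/
def stateGraph (s : Finset G.edgeSet) : SimpleGraph V :=
  SimpleGraph.fromEdgeSet {e : Sym2 V | ∃ h : e ∈ G.edgeSet, (⟨e, h⟩ : G.edgeSet) ∈ s}

theorem stateGraph_mono {s t : Finset G.edgeSet} (h : s ⊆ t) :
    stateGraph G s ≤ stateGraph G t :=
  SimpleGraph.fromEdgeSet_mono fun _ ⟨he, hs⟩ => ⟨he, h hs⟩

/-- The connected components of `[G : s]`. -/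
abbrev StateComponent (s : Finset G.edgeSet) : Type _ :=
  (stateGraph G s).ConnectedComponent

instance [Finite V] (s : Finset G.edgeSet) : Fintype (StateComponent G s) :=
  haveI : Finite (StateComponent G s) := Quot.finite _
  Fintype.ofFinite _

/-- For `s ⊆ t`, the map that sends a component of `[G : s]` to the component of `[G : t]`
containing it. -/
def componentMap {s t : Finset G.edgeSet} (h : s ⊆ t) :
    StateComponent G s → StateComponent G t :=
  SimpleGraph.ConnectedComponent.map (SimpleGraph.Hom.ofLE (stateGraph_mono G h))

variable (R : Type*) [CommRing R] (A : Type*) [CommRing A] [Algebra R A]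

/-- `C^i(G) = ⨁_{|s| = i} A^{⊗ k(s)}`, with one tensor factor for every component of `[G : s]`. -/
abbrev Cochain (i : ℕ) : Type _ :=
  (s : {s : Finset G.edgeSet // s.card = i}) → ⨂[R] _ : StateComponent G s.1, A

variable [Finite V]

open Classical in
/-- The differential `d^i = ∑_{e ∉ s} (-1)^{t(s,e)} d_e`, where `t(s, e)` is the number of edges
of `s` that precede `e` in the ordering of the edges given by the numbering `num`. The map
`d_e : A^{⊗ k(s)} → A^{⊗ k(s ∪ e)}` multiplies the two tensor factors of the components that `e`
joins, and it is the identity if both ends of `e` lie in the same component of `[G : s]`. Below,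
the component of `d^i f` at a state `t` with `i + 1` edges is written out: the states `s` and
edges `e ∉ s` with `s ∪ e = t` are the `s = t \ e` with `e ∈ t`. -/
def d (num : G.edgeSet ↪ ℕ) (i : ℕ) : Cochain G R A i →ₗ[R] Cochain G R A (i + 1) :=
  LinearMap.pi fun t => ∑ e : {e // e ∈ t.1},
    ((-1 : R) ^ ((t.1.erase e.1).filter (num · < num e.1)).card) •
      (mergeMap R A (componentMap G (Finset.erase_subset e.1 t.1)) ∘ₗ
        LinearMap.proj (⟨t.1.erase e.1, by
          rw [Finset.card_erase_of_mem e.2, t.2, Nat.add_sub_cancel]⟩ :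
            {s : Finset G.edgeSet // s.card = i}))

variable {A} (gr : ℕ → Submodule R A)

/-- The homogeneous part `C^{i,j}(G)` of degree `j` of `C^i(G)`. -/
def cochainDegree (i j : ℕ) : Submodule R (Cochain G R A i) :=
  Submodule.pi Set.univ fun s => tensorDegree R gr (StateComponent G s.1) j

variable (num : G.edgeSet ↪ ℕ)

/-- The cocycles of bidegree `(i, j)`. -/
def cocycles (i j : ℕ) : Submodule R (Cochain G R A i) :=
  cochainDegree G R gr i j ⊓ LinearMap.ker (d G R A num i)

/-- The coboundaries of bidegree `(i, j)`: the image of `C^{i-1,j}(G)`. -/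
def coboundaries : (i j : ℕ) → Submodule R (Cochain G R A i)
  | 0, _ => ⊥
  | i + 1, j => (cochainDegree G R gr i j).map (d G R A num i)

/-- The chromatic graph cohomology `H^{i,j}_A(G)` of `G` over the graded algebra `A`. -/
abbrev Cohomology (i j : ℕ) : Type _ :=
  ↥(cocycles G R gr num i j) ⧸ (coboundaries G R gr num i j).submoduleOf (cocycles G R gr num i j)

end Graph

/-! ### The algebras `ℤ[x]/(x^m)` -/

/-- `A_m = ℤ[x]/(x^m)`. -/
abbrev TruncPoly (m : ℕ) : Type := AdjoinRoot (Polynomial.X ^ m : Polynomial ℤ)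

/-- The grading of `A_m` with `x` in degree one: the degree `k` part is spanned by `x^k`. -/
def truncGrading (m k : ℕ) : Submodule ℤ (TruncPoly m) :=
  Submodule.span ℤ {AdjoinRoot.root (Polynomial.X ^ m : Polynomial ℤ) ^ k}

/-- `H^{i,j}_{A_m}(G)`. -/
abbrev TruncCohomology (m : ℕ) {V : Type*} [Finite V] (G : SimpleGraph V)
    (num : G.edgeSet ↪ ℕ) (i j : ℕ) : Type _ :=
  Cohomology G ℤ (truncGrading m) num i j

/-! ### Wheels -/

/-- The cone over a graph: a new vertex `none` is joined to all the old vertices. -/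
def cone {V : Type*} (G : SimpleGraph V) : SimpleGraph (Option V) where
  Adj
    | none, none => False
    | none, some _ => True
    | some _, none => True
    | some a, some b => G.Adj a b
  symm := ⟨by
    rintro (_ | a) (_ | b) h
    · exact h
    · trivial
    · trivial
    · exact SimpleGraph.Adj.symm h⟩
  loopless := ⟨by
    rintro (_ | a) h
    · exact h
    · exact G.loopless.irrefl _ h⟩

/-- The wheel `W_n`, with `n` vertices: the cone over the `(n - 1)`-gon. It is meant for
`4 ≤ n`. -/
def wheel (n : ℕ) : SimpleGraph (Option (Fin (n - 1))) :=
  cone (SimpleGraph.cycleGraph (n - 1))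

end

end ChromaticCohomology

namespace ChromaticCohomology

/-! Measure a monomial by its deficit, the amount by which its exponents fall short of 2 in every
tensor factor. For a graph on `n` vertices and in degree `2n - 3`, the deficit is 3 on the empty
state and 1 on a state with one edge; on a state with two edges it would be negative. So the second
cochain group vanishes and every 1-cochain of this degree is a cocycle. The 1-cochains are free on
pairs (edge, component of deficit 1), which are the `edgeGen G u v w`. The coboundaries come from
the two ways to spread deficit 3 over vertices with at most 2 at each: 2 + 1 gives the star relation
`sum_eq_zero`, and 1 + 1 + 1 gives the relation `cyclic`. This is the presentation
`exists_universal_edgeSystem`.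

For a wheel the relations are solved explicitly. The values at rim edges and rim vertices are
parametrized by two families `α`, `ρ` indexed by the rim. The star relations at rim vertices then
determine the spokes, and the triangles through the hub determine the values at the hub. Only the
star relations at the hub are left over, and they read `3(α_{i-1} + α_i) = 0`
(`IsEdgeSystem.eq_wheelSystem`, `sum_wheelSystem_hub`, `isEdgeSystem_wheelSystem`). The `ρ_i` are
free, except that on a triangular rim only their differences matter, so `ρ_0 = 0` is imposed.

It remains to identify the group. Going round the rim, `3α_i = (-1)^i 3α_0`. On an even rim this
closes up, so `α_0` is free and each `(-1)^i α_i - α_0` with `i ≠ 0` spans a `ℤ/3`. On an odd rim it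
forces `6α_0 = 0`, so the `4α_i` give copies of `ℤ/3` and the common element `3α_0` gives the `ℤ/2`.
-/

/-! ### Monomials in tensor powers of `ℤ[x]/(x^3)` -/

/-- The monomial `⊗_i x^{w i}` in the tensor power of `ℤ[x]/(x^3)`. -/
noncomputable def mono {ι : Type*} (w : ι → ℕ) : ⨂[ℤ] _ : ι, TruncPoly 3 :=
  PiTensorProduct.tprod ℤ fun i => AdjoinRoot.root (Polynomial.X ^ 3 : Polynomial ℤ) ^ w i

open Classical in
/-- The monomial with exponent `1` at `c` and exponent `2` everywhere else. -/
noncomputable def nearTop {ι : Type*} (c : ι) : ⨂[ℤ] _ : ι, TruncPoly 3 :=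
  mono fun i => if i = c then 1 else 2

theorem root_pow_eq_zero {k : ℕ} (hk : 3 ≤ k) :
    AdjoinRoot.root (Polynomial.X ^ 3 : Polynomial ℤ) ^ k = 0 := by
  have h : AdjoinRoot.root (Polynomial.X ^ 3 : Polynomial ℤ) ^ 3 = 0 := by
    have := AdjoinRoot.mk_self (f := (Polynomial.X ^ 3 : Polynomial ℤ))
    rwa [map_pow, AdjoinRoot.mk_X] at this
  exact pow_eq_zero_of_le hk h

theorem mono_eq_zero {ι : Type*} {w : ι → ℕ} {i : ι} (hi : 3 ≤ w i) : mono w = 0 :=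
  (PiTensorProduct.tprod ℤ).map_coord_zero i (root_pow_eq_zero hi)

theorem mono_mem_tensorDegree {ι : Type*} [Fintype ι] {w : ι → ℕ} {j : ℕ} (h : ∑ i, w i = j) :
    mono w ∈ tensorDegree ℤ (truncGrading 3) ι j :=
  Submodule.subset_span ⟨w, _, fun _ => Submodule.mem_span_singleton_self _, h, rfl⟩

open Classical in
theorem mergeMap_mono {ι κ : Type*} [Fintype ι] (f : ι → κ) (w : ι → ℕ) :
    mergeMap ℤ (TruncPoly 3) f (mono w) = mono fun k => ∑ i with f i = k, w i := by
  simp only [mono, mergeMap_tprod, Finset.prod_pow_eq_pow_sum]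

theorem tensorDegree_le_span_mono (ι : Type*) [Fintype ι] (j : ℕ) :
    tensorDegree ℤ (truncGrading 3) ι j ≤
      Submodule.span ℤ {t | ∃ w : ι → ℕ, (∀ i, w i ≤ 2) ∧ ∑ i, w i = j ∧ mono w = t} := by
  refine Submodule.span_le.2 ?_
  rintro _ ⟨w, a, ha, hw, rfl⟩
  choose z hz using fun i => Submodule.mem_span_singleton.1 (ha i)
  obtain rfl : (fun i => z i • AdjoinRoot.root (Polynomial.X ^ 3 : Polynomial ℤ) ^ w i) = a :=
    funext hz
  rw [MultilinearMap.map_smul_univ]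
  refine Submodule.smul_mem _ _ ?_
  change mono w ∈ _
  by_cases h : ∀ i, w i ≤ 2
  · exact Submodule.subset_span ⟨w, h, hw, rfl⟩
  · push Not at h
    obtain ⟨i, hi⟩ := h
    rw [mono_eq_zero hi]
    exact Submodule.zero_mem _

theorem tensorDegree_eq_bot {ι : Type*} [Fintype ι] {j : ℕ} (h : 2 * Fintype.card ι < j) :
    tensorDegree ℤ (truncGrading 3) ι j = ⊥ := by
  refine le_bot_iff.1 ((tensorDegree_le_span_mono ι j).trans (Submodule.span_le.2 ?_))
  rintro _ ⟨w, hw, hj, rfl⟩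
  have : ∑ i, w i ≤ _ := Finset.sum_le_card_nsmul Finset.univ w 2 fun i _ => hw i
  simp only [Finset.card_univ, smul_eq_mul] at this
  omega

theorem tensorDegree_le_span_nearTop {ι : Type*} [Fintype ι] {j : ℕ}
    (h : j + 1 = 2 * Fintype.card ι) :
    tensorDegree ℤ (truncGrading 3) ι j ≤ Submodule.span ℤ (Set.range nearTop) := by
  classical
  refine (tensorDegree_le_span_mono ι j).trans (Submodule.span_mono ?_)
  rintro _ ⟨w, hw, hj, rfl⟩
  -- The total deficit is 1, so it sits at a single factor. The subtraction does not truncate, by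
  -- `hw`.
  have hs : ∑ i, (2 - w i) = 1 := by
    have h2 : ∑ i, (2 - w i) + ∑ i, w i = 2 * Fintype.card ι := by
      rw [← Finset.sum_add_distrib, Finset.sum_congr rfl fun i _ => Nat.sub_add_cancel (hw i)]
      simp [mul_comm]
    omega
  obtain ⟨c, hc⟩ : ∃ c, 2 - w c ≠ 0 := by
    by_contra! hcon
    simp [hcon] at hs
  rw [← Finset.add_sum_erase _ _ (Finset.mem_univ c)] at hs
  have h0 : ∑ i ∈ Finset.univ.erase c, (2 - w i) = 0 := by omega
  refine ⟨c, ?_⟩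
  unfold nearTop
  congr 1
  funext i
  have hi := hw i
  split_ifs with hic
  · subst hic; omega
  · have := Finset.sum_eq_zero_iff.1 h0 i (by simp [hic])
    omega

theorem nearTop_mem_tensorDegree {ι : Type*} [Fintype ι] {j : ℕ}
    (h : j + 1 = 2 * Fintype.card ι) (c : ι) :
    nearTop c ∈ tensorDegree ℤ (truncGrading 3) ι j := by
  classical
  refine mono_mem_tensorDegree ?_
  have h1 : ∑ i : ι, ((if i = c then 1 else 2) + if i = c then 1 else 0) = 2 * Fintype.card ι := by
    rw [Finset.sum_congr rfl (g := fun _ => 2) fun i _ => by split_ifs <;> rfl]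
    simp [mul_comm]
  rw [Finset.sum_add_distrib, Finset.sum_ite_eq' Finset.univ c] at h1
  simp only [Finset.mem_univ, if_true] at h1
  convert (by omega : (∑ i : ι, if i = c then 1 else 2) = j)

/-- The coefficient of `x^k` of an element of `ℤ[x]/(x^3)`. -/
noncomputable def truncCoeff (k : ℕ) : TruncPoly 3 →ₗ[ℤ] ℤ :=
  Polynomial.lcoeff ℤ k ∘ₗ AdjoinRoot.modByMonicHom (Polynomial.monic_X_pow 3)

theorem truncCoeff_root_pow (k : ℕ) {l : ℕ} (hl : l ≤ 2) :
    truncCoeff k (AdjoinRoot.root (Polynomial.X ^ 3 : Polynomial ℤ) ^ l) =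
      if k = l then 1 else 0 := by
  rw [← AdjoinRoot.mk_X, ← map_pow, truncCoeff, LinearMap.comp_apply,
    AdjoinRoot.modByMonicHom_mk, (Polynomial.modByMonic_eq_self_iff (Polynomial.monic_X_pow 3)).2,
    Polynomial.lcoeff_apply, Polynomial.coeff_X_pow]
  rw [Polynomial.degree_X_pow, Polynomial.degree_X_pow]
  exact_mod_cast (by omega : l < 3)

open Classical in
/-- The coefficient of the monomial `nearTop c`. -/
noncomputable def nearTopCoeff {ι : Type*} [Fintype ι] (c : ι) :
    (⨂[ℤ] _ : ι, TruncPoly 3) →ₗ[ℤ] ℤ :=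
  PiTensorProduct.lift ((MultilinearMap.mkPiAlgebra ℤ ι ℤ).compLinearMap fun i =>
    truncCoeff (if i = c then 1 else 2))

open Classical in
-- For `c ≠ c'` the factor at `c` of `nearTop c'` is `x^2`, which has no linear coefficient.
-- Together the `nearTopCoeff c` are dual to the near-top monomials, which allows homomorphisms out
-- of the cochains to be prescribed on them.
theorem nearTopCoeff_nearTop {ι : Type*} [Fintype ι] (c c' : ι) :
    nearTopCoeff c (nearTop c') = if c = c' then 1 else 0 := by
  simp only [nearTopCoeff, nearTop, mono, PiTensorProduct.lift.tprod,
    MultilinearMap.compLinearMap_apply, MultilinearMap.mkPiAlgebra_apply]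
  split_ifs with h
  · subst h
    refine Finset.prod_eq_one fun i _ => ?_
    rw [truncCoeff_root_pow _ (by split_ifs <;> omega), if_pos rfl]
  · refine Finset.prod_eq_zero (Finset.mem_univ c) ?_
    rw [truncCoeff_root_pow _ (by split_ifs; omega), if_pos rfl, if_neg h, if_neg (by omega)]

theorem mergeMap_mem_tensorDegree {ι κ : Type*} [Fintype ι] [Fintype κ] (f : ι → κ) {j : ℕ}
    {t : ⨂[ℤ] _ : ι, TruncPoly 3} (ht : t ∈ tensorDegree ℤ (truncGrading 3) ι j) :
    mergeMap ℤ (TruncPoly 3) f t ∈ tensorDegree ℤ (truncGrading 3) κ j := by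
  classical
  suffices h : tensorDegree ℤ (truncGrading 3) ι j ≤
      (tensorDegree ℤ (truncGrading 3) κ j).comap (mergeMap ℤ (TruncPoly 3) f) from h ht
  refine (tensorDegree_le_span_mono ι j).trans (Submodule.span_le.2 ?_)
  rintro _ ⟨w, -, hj, rfl⟩
  rw [SetLike.mem_coe, Submodule.mem_comap, mergeMap_mono]
  exact mono_mem_tensorDegree ((Finset.sum_fiberwise _ _ _).trans hj)

/-! ### Components of states with few edges -/

section Components

variable {V : Type*} {G : SimpleGraph V}

theorem stateGraph_adj {s : Finset G.edgeSet} {u v : V} :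
    (stateGraph G s).Adj u v ↔ (∃ e ∈ s, e.1 = s(u, v)) ∧ u ≠ v := by
  rw [stateGraph, SimpleGraph.fromEdgeSet_adj]
  refine and_congr_left fun _ => ⟨?_, ?_⟩
  · rintro ⟨h, hs⟩
    exact ⟨_, hs, rfl⟩
  · rintro ⟨⟨e, he⟩, hs, rfl⟩
    exact ⟨he, hs⟩

/-- The component of a vertex. -/
abbrev comp (s : Finset G.edgeSet) (v : V) : StateComponent G s :=
  (stateGraph G s).connectedComponentMk v

/-- A vertex of a component. -/
noncomputable def rep {s : Finset G.edgeSet} (c : StateComponent G s) : V := Quot.out c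

theorem comp_rep {s : Finset G.edgeSet} (c : StateComponent G s) : comp s (rep c) = c :=
  Quot.out_eq c

theorem comp_eq_comp_of_card_eq_zero {s : Finset G.edgeSet} (hs : s.card = 0) {u v : V} :
    comp s u = comp s v ↔ u = v := by
  refine ⟨fun h => ?_, fun h => h ▸ rfl⟩
  obtain ⟨p⟩ := SimpleGraph.ConnectedComponent.eq.1 h
  cases p with
  | nil => rfl
  | cons h _ =>
    obtain ⟨e, he, -⟩ := (stateGraph_adj.1 h).1
    rw [Finset.card_eq_zero.1 hs] at he
    exact absurd he (Finset.notMem_empty _)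

theorem comp_eq_comp_of_eq_singleton {s : Finset G.edgeSet} {e : G.edgeSet} (hs : s = {e})
    {u v : V} : comp s u = comp s v ↔ u = v ∨ (u ∈ e.1 ∧ v ∈ e.1) := by
  subst hs
  refine ⟨fun h => ?_, ?_⟩
  · obtain ⟨p⟩ := SimpleGraph.ConnectedComponent.eq.1 h
    clear h
    induction p with
    | nil => exact Or.inl rfl
    | @cons a b c h p ih =>
      obtain ⟨⟨e', he', heq⟩, -⟩ := stateGraph_adj.1 h
      rw [Finset.mem_singleton] at he'
      subst he'
      have ha : a ∈ e'.1 := heq ▸ Sym2.mem_mk_left a b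
      have hb : b ∈ e'.1 := heq ▸ Sym2.mem_mk_right a b
      rcases ih with rfl | ⟨-, hc⟩
      · exact Or.inr ⟨ha, hb⟩
      · exact Or.inr ⟨ha, hc⟩
  · rintro (rfl | ⟨hu, hv⟩)
    · rfl
    · by_cases huv : u = v
      · rw [huv]
      · refine SimpleGraph.ConnectedComponent.eq.2 (SimpleGraph.Adj.reachable ?_)
        exact stateGraph_adj.2 ⟨⟨e, Finset.mem_singleton_self e,
          ((Sym2.mem_and_mem_iff huv).1 ⟨hu, hv⟩)⟩, huv⟩

theorem componentMap_comp {s t : Finset G.edgeSet} (h : s ⊆ t) (v : V) :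
    componentMap G h (comp s v) = comp t v := rfl

variable [Fintype V]

theorem card_stateComponent_of_card_eq_one {s : Finset G.edgeSet} (hs : s.card = 1) :
    Fintype.card (StateComponent G s) + 1 = Fintype.card V := by
  classical
  obtain ⟨e, rfl⟩ := Finset.card_eq_one.1 hs
  obtain ⟨⟨x, y⟩, hxy⟩ := e
  have hne : x ≠ y := SimpleGraph.Adj.ne hxy
  -- Contracting the edge `xy` identifies only `x` with `y`, so the vertices other than `y`
  -- represent each component once.
  have hb : Function.Bijective fun v : {v // v ≠ y} => comp {(⟨s(x, y), hxy⟩ : G.edgeSet)} v.1 := by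
    constructor
    · rintro ⟨u, hu⟩ ⟨v, hv⟩ h
      rcases (comp_eq_comp_of_eq_singleton rfl).1 h with h | ⟨h1, h2⟩
      · exact Subtype.ext h
      · rcases Sym2.mem_iff.1 h1 with rfl | h1
        · rcases Sym2.mem_iff.1 h2 with h2 | h2
          · exact Subtype.ext h2.symm
          · exact absurd h2 hv
        · exact absurd h1 hu
    · intro c
      obtain ⟨v, rfl⟩ : ∃ v, comp _ v = c := ⟨rep c, comp_rep c⟩
      by_cases hv : v = y
      · refine ⟨⟨x, hne⟩, ?_⟩
        exact (comp_eq_comp_of_eq_singleton rfl).2 (Or.inr ⟨Sym2.mem_mk_left _ _,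
          hv ▸ Sym2.mem_mk_right _ _⟩)
      · exact ⟨⟨v, hv⟩, rfl⟩
  rw [← Fintype.card_of_bijective hb, Fintype.card_subtype_compl, Fintype.card_subtype_eq]
  have : 0 < Fintype.card V := Fintype.card_pos_iff.2 ⟨x⟩
  omega

/-- In a simple graph a second edge `e ≠ f` cannot have the same two ends as `f`, so adding it to
`{f}` merges two different components. -/
theorem card_stateComponent_of_card_eq_two {s : Finset G.edgeSet} (hs : s.card = 2) :
    Fintype.card (StateComponent G s) + 2 ≤ Fintype.card V := by
  classical
  obtain ⟨e, f, hef, rfl⟩ := Finset.card_eq_two.1 hs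
  rw [← card_stateComponent_of_card_eq_one (Finset.card_singleton f)]
  have hsub : ({f} : Finset G.edgeSet) ⊆ {e, f} := by simp
  have : Fintype.card (StateComponent G {e, f}) < Fintype.card (StateComponent G {f}) := by
    refine Fintype.card_lt_of_surjective_not_injective (componentMap G hsub) ?_ ?_
    · intro c
      exact ⟨comp _ (rep c), comp_rep c⟩
    · intro hinj
      obtain ⟨⟨x, y⟩, hxy⟩ := e
      have hne : x ≠ y := SimpleGraph.Adj.ne hxy
      have h : comp {f} x = comp {f} y := by
        apply hinj
        refine SimpleGraph.ConnectedComponent.eq.2 (SimpleGraph.Adj.reachable ?_)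
        exact stateGraph_adj.2 ⟨⟨_, Finset.mem_insert_self _ _, rfl⟩, hne⟩
      rcases (comp_eq_comp_of_eq_singleton rfl).1 h with h | h
      · exact hne h
      · exact hef (Subtype.ext ((Sym2.mem_and_mem_iff hne).1 h).symm)
  omega

end Components

/-! ### Cochains of low degree over `ℤ[x]/(x^3)` -/

section Cochains

variable {V : Type*} (G : SimpleGraph V)

/-- The cochain of degree zero `⊗_v x^{w v}`. -/
noncomputable def vertexMono (w : V → ℕ) : Cochain G ℤ (TruncPoly 3) 0 :=
  fun _ => mono fun c => w (rep c)

open Classical in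
/-- The cochain of degree one that is supported at the edge `uv` (it is zero if there is no such
edge), with exponent `1` at the component of `w` and exponent `2` at all other components. -/
noncomputable def edgeGen (u v w : V) : Cochain G ℤ (TruncPoly 3) 1 :=
  fun t => if ∃ e ∈ t.1, e.1 = s(u, v) then nearTop (comp t.1 w) else 0

variable {G}

theorem edgeGen_comm (u v w : V) : edgeGen G u v w = edgeGen G v u w := by
  unfold edgeGen
  rw [Sym2.eq_swap]

theorem edgeGen_left_eq_right (u v : V) : edgeGen G u v u = edgeGen G u v v := by
  funext t
  unfold edgeGen
  split_ifs with h
  · obtain ⟨e, he, heq⟩ := h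
    obtain ⟨e', he'⟩ := Finset.card_eq_one.1 t.2
    obtain rfl : e = e' := by rwa [he', Finset.mem_singleton] at he
    rw [(comp_eq_comp_of_eq_singleton he').2 (Or.inr ⟨heq ▸ Sym2.mem_mk_left _ _,
      heq ▸ Sym2.mem_mk_right _ _⟩)]
  · rfl

theorem edgeGen_eq_zero {u v : V} (h : ¬ G.Adj u v) (w : V) : edgeGen G u v w = 0 := by
  funext t
  refine if_neg ?_
  rintro ⟨⟨e, he⟩, -, rfl⟩
  exact h he

variable [Fintype V]

theorem edgeGen_mem_cochainDegree {j : ℕ} (hj : j + 3 = 2 * Fintype.card V) (u v w : V) :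
    edgeGen G u v w ∈ cochainDegree G ℤ (truncGrading 3) 1 j := by
  rintro t -
  have := card_stateComponent_of_card_eq_one t.2
  simp only [edgeGen]
  split_ifs
  · exact nearTop_mem_tensorDegree (by omega) _
  · exact Submodule.zero_mem _

theorem cochainDegree_one_le {j : ℕ} (hj : j + 3 = 2 * Fintype.card V) :
    cochainDegree G ℤ (truncGrading 3) 1 j ≤
      Submodule.span ℤ {x | ∃ u v w, edgeGen G u v w = x} := by
  classical
  have : Finite G.edgeSet := inferInstance
  have := Fintype.ofFinite G.edgeSet
  unfold cochainDegree
  -- A product over finitely many states is generated by cochains supported at one state.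
  rw [← Submodule.iSup_map_single]
  refine iSup_le fun t => ?_
  have hc := card_stateComponent_of_card_eq_one t.2
  rw [Submodule.map_le_iff_le_comap]
  refine (tensorDegree_le_span_nearTop (by omega)).trans (Submodule.span_le.2 ?_)
  rintro _ ⟨c, rfl⟩
  refine Submodule.subset_span ?_
  obtain ⟨e, he⟩ := Finset.card_eq_one.1 t.2
  obtain ⟨⟨x, y⟩, hxy⟩ := e
  refine ⟨x, y, rep c, ?_⟩
  funext t'
  simp only [edgeGen, LinearMap.coe_single]
  by_cases htt : t' = t
  · subst htt
    rw [Pi.single_eq_same, comp_rep, if_pos ⟨_, he ▸ Finset.mem_singleton_self _, rfl⟩]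
  · rw [Pi.single_eq_of_ne htt, if_neg]
    rintro ⟨e', he', heq⟩
    apply htt
    obtain ⟨e'', he''⟩ := Finset.card_eq_one.1 t'.2
    rw [he'', Finset.mem_singleton] at he'
    subst he'
    apply Subtype.ext
    rw [he, he'', Finset.singleton_inj]
    exact Subtype.ext heq

theorem sum_comp_of_card_eq_zero {s : Finset G.edgeSet} (hs : s.card = 0) (f : V → ℕ) :
    ∑ c : StateComponent G s, f (rep c) = ∑ v, f v := by
  refine Fintype.sum_bijective rep ⟨fun c c' h => ?_, fun v => ?_⟩ _ _ fun _ => rfl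
  · rw [← comp_rep c, h, comp_rep]
  · exact ⟨comp s v, (comp_eq_comp_of_card_eq_zero hs).1 (comp_rep _)⟩

theorem vertexMono_mem_cochainDegree {w : V → ℕ} {j : ℕ} (h : ∑ v, w v = j) :
    vertexMono G w ∈ cochainDegree G ℤ (truncGrading 3) 0 j := by
  rintro t -
  exact mono_mem_tensorDegree ((sum_comp_of_card_eq_zero t.2 w).trans h)

theorem cochainDegree_zero_le (j : ℕ) :
    cochainDegree G ℤ (truncGrading 3) 0 j ≤
      Submodule.span ℤ {x | ∃ w : V → ℕ, (∀ v, w v ≤ 2) ∧ ∑ v, w v = j ∧ vertexMono G w = x} := by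
  classical
  have : Finite G.edgeSet := inferInstance
  have := Fintype.ofFinite G.edgeSet
  unfold cochainDegree
  rw [← Submodule.iSup_map_single]
  refine iSup_le fun t => ?_
  rw [Submodule.map_le_iff_le_comap]
  refine (tensorDegree_le_span_mono _ j).trans (Submodule.span_le.2 ?_)
  rintro _ ⟨w, hw, hj, rfl⟩
  have hw' : (fun c => w (comp t.1 (rep c))) = w := funext fun c => by rw [comp_rep]
  refine Submodule.subset_span ⟨fun v => w (comp t.1 v), fun _ => hw _, ?_, ?_⟩
  · rw [← sum_comp_of_card_eq_zero t.2, hw', hj]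
  · funext t'
    obtain rfl : t' = t :=
      Subtype.ext ((Finset.card_eq_zero.1 t'.2).trans (Finset.card_eq_zero.1 t.2).symm)
    simp only [vertexMono, LinearMap.coe_single, Pi.single_eq_same, hw']

section Generic
variable {R A : Type*} [CommRing R] [CommRing A] [Algebra R A]

open Classical in
theorem d_apply (num : G.edgeSet ↪ ℕ) (i : ℕ) (x : Cochain G R A i)
    (t : {s : Finset G.edgeSet // s.card = i + 1}) :
    d G R A num i x t = ∑ e : {e // e ∈ t.1},
      ((-1 : R) ^ ((t.1.erase e.1).filter (num · < num e.1)).card) •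
        mergeMap R A (componentMap G (Finset.erase_subset e.1 t.1))
          (x ⟨t.1.erase e.1, by rw [Finset.card_erase_of_mem e.2, t.2, Nat.add_sub_cancel]⟩) := by
  rw [d, LinearMap.pi_apply, LinearMap.sum_apply]
  rfl

theorem d_apply_zero (num : G.edgeSet ↪ ℕ) (x : Cochain G R A 0)
    (t : {s : Finset G.edgeSet // s.card = 0 + 1}) :
    d G R A num 0 x t = mergeMap R A (componentMap G (Finset.empty_subset t.1))
      (x ⟨∅, Finset.card_empty⟩) := by
  classical
  obtain ⟨t, ht⟩ := t
  obtain ⟨e, rfl⟩ := Finset.card_eq_one.1 ht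
  -- Generalizing over `s` allows the dependent replacement of the erased singleton by `∅`.
  have key : ∀ (s : Finset G.edgeSet) (h0 : s.card = 0) (hsub : s ⊆ {e}) ,
      mergeMap R A (componentMap G hsub) (x ⟨s, h0⟩) =
      mergeMap R A (componentMap G (Finset.empty_subset {e})) (x ⟨∅, Finset.card_empty⟩) := by
    intro s h0 hsub
    obtain rfl := Finset.card_eq_zero.1 h0
    rfl
  have : Unique {e' // e' ∈ ({e} : Finset G.edgeSet)} :=
    ⟨⟨⟨e, Finset.mem_singleton_self e⟩⟩, fun x => Subtype.ext (Finset.mem_singleton.1 x.2)⟩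
  rw [d_apply, Finset.sum_congr rfl (g := fun _ => mergeMap R A
    (componentMap G (Finset.empty_subset {e})) (x ⟨∅, Finset.card_empty⟩)), Fintype.sum_unique]
  rintro ⟨e', he'⟩ -
  obtain rfl := Finset.mem_singleton.1 he'
  rw [key _ _ _, Finset.card_eq_zero.2, pow_zero, one_smul]
  ext
  simp

theorem d_mem_cochainDegree {gr : ℕ → Submodule R A} {j : ℕ}
    (hgr : ∀ {s t : Finset G.edgeSet} (h : s ⊆ t), ∀ y ∈ tensorDegree R gr (StateComponent G s) j,
      mergeMap R A (componentMap G h) y ∈ tensorDegree R gr (StateComponent G t) j)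
    (num : G.edgeSet ↪ ℕ) {i : ℕ} {x : Cochain G R A i} (hx : x ∈ cochainDegree G R gr i j) :
    d G R A num i x ∈ cochainDegree G R gr (i + 1) j := by
  classical
  intro t ht
  have hx' : ∀ s, x s ∈ tensorDegree R gr (StateComponent G s.1) j := fun s => hx s trivial
  rw [d_apply]
  refine Submodule.sum_mem _ fun e he => ?_
  refine Submodule.smul_mem _ _ ?_
  have h1 := hx' ⟨t.1.erase e.1, by rw [Finset.card_erase_of_mem e.2, t.2, Nat.add_sub_cancel]⟩
  exact hgr (Finset.erase_subset e.1 t.1) _ h1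

theorem cochainDegree_eq_bot {gr : ℕ → Submodule R A} {i j : ℕ}
    (h : ∀ s : Finset G.edgeSet, s.card = i → tensorDegree R gr (StateComponent G s) j = ⊥) :
    cochainDegree G R gr i j = ⊥ := by
  refine (Submodule.eq_bot_iff _).2 fun x hx => funext fun t => ?_
  exact (Submodule.eq_bot_iff _).1 (h t.1 t.2) _ (hx t trivial)

end Generic

/-- The differential preserves the degree, and two edges leave at most `|V| - 2` components, whose
top degree `2|V| - 4` is below `j`. -/
theorem cochainDegree_one_le_ker_d (num : G.edgeSet ↪ ℕ) {j : ℕ}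
    (hj : j + 3 = 2 * Fintype.card V) :
    cochainDegree G ℤ (truncGrading 3) 1 j ≤ LinearMap.ker (d G ℤ (TruncPoly 3) num 1) := by
  intro x hx
  have hbot : cochainDegree G ℤ (truncGrading 3) (1 + 1) j = ⊥ :=
    cochainDegree_eq_bot fun s hs =>
      tensorDegree_eq_bot (by have := card_stateComponent_of_card_eq_two hs; omega)
  have h := d_mem_cochainDegree (fun h y hy => mergeMap_mem_tensorDegree _ hy) num hx
  rw [hbot] at h
  exact h

open Classical in
theorem d_vertexMono (num : G.edgeSet ↪ ℕ) (w : V → ℕ)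
    (t : {s : Finset G.edgeSet // s.card = 0 + 1}) :
    d G ℤ (TruncPoly 3) num 0 (vertexMono G w) t =
      mono fun k => ∑ v with comp t.1 v = k, w v := by
  rw [d_apply_zero, vertexMono, mergeMap_mono]
  congr 1
  funext k
  refine Finset.sum_bij (fun c _ => rep c) ?_ ?_ ?_ ?_
  · intro c hc
    rw [Finset.mem_filter] at hc ⊢
    refine ⟨Finset.mem_univ _, ?_⟩
    rw [← hc.2, ← componentMap_comp (Finset.empty_subset t.1), comp_rep]
  · intro c _ c' _ h
    rw [← comp_rep c, h, comp_rep]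
  · intro v hv
    rw [Finset.mem_filter] at hv
    refine ⟨comp ∅ v, Finset.mem_filter.2 ⟨Finset.mem_univ _, hv.2⟩, ?_⟩
    exact (comp_eq_comp_of_card_eq_zero Finset.card_empty).1 (comp_rep _)
  · intro _ _
    rfl

end Cochains

/-! ### Coboundaries in degree `2|V| - 3` -/

section Relations

variable {V : Type*} {G : SimpleGraph V}

open Classical in
theorem edgeGen_apply {t : {s : Finset G.edgeSet // s.card = 1}} {e : G.edgeSet} (ht : t.1 = {e})
    (u v w : V) : edgeGen G u v w t = if e.1 = s(u, v) then nearTop (comp t.1 w) else 0 := by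
  simp only [edgeGen, ht, Finset.mem_singleton, exists_eq_left]

variable [Fintype V]

open Classical in
theorem sum_fiber_comp {t : Finset G.edgeSet} {e : G.edgeSet} (ht : t = {e}) {x y : V}
    (he : e.1 = s(x, y)) (w : V → ℕ) (z : V) :
    ∑ v with comp t v = comp t z, w v = if z = x ∨ z = y then w x + w y else w z := by
  have hxy : x ≠ y := SimpleGraph.Adj.ne (he ▸ e.2 : s(x, y) ∈ G.edgeSet)
  simp only [comp_eq_comp_of_eq_singleton ht, he, Sym2.mem_iff]
  split_ifs with h
  · rw [← Finset.sum_pair hxy]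
    refine Finset.sum_congr ?_ fun _ _ => rfl
    ext v
    simp only [Finset.mem_filter, Finset.mem_univ, true_and, Finset.mem_insert,
      Finset.mem_singleton]
    grind
  · rw [← Finset.sum_singleton w z]
    refine Finset.sum_congr ?_ fun _ _ => rfl
    ext v
    simp [h]

theorem d_vertexMono_eq_zero (num : G.edgeSet ↪ ℕ) {t : {s : Finset G.edgeSet // s.card = 0 + 1}}
    {e : G.edgeSet} (ht : t.1 = {e}) {x y : V} (he : e.1 = s(x, y)) {w : V → ℕ}
    (hw : 3 ≤ w x + w y) : d G ℤ (TruncPoly 3) num 0 (vertexMono G w) t = 0 := by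
  classical
  rw [d_vertexMono]
  refine mono_eq_zero (i := comp t.1 x) ?_
  rw [sum_fiber_comp ht he, if_pos (Or.inl rfl)]
  exact hw

open Classical in
theorem d_vertexMono_eq_nearTop (num : G.edgeSet ↪ ℕ)
    {t : {s : Finset G.edgeSet // s.card = 0 + 1}}
    {e : G.edgeSet} (ht : t.1 = {e}) {x y : V} (he : e.1 = s(x, y)) {w : V → ℕ} (c : V)
    (hw : w x + w y = if c = x ∨ c = y then 1 else 2)
    (hz : ∀ z, z ≠ x → z ≠ y → w z = if z = c then 1 else 2) :
    d G ℤ (TruncPoly 3) num 0 (vertexMono G w) t = nearTop (comp t.1 c) := by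
  rw [d_vertexMono, nearTop]
  congr 1
  funext k
  obtain ⟨z, rfl⟩ : ∃ z, comp t.1 z = k := ⟨_, comp_rep k⟩
  rw [sum_fiber_comp ht he, comp_eq_comp_of_eq_singleton ht, he, Sym2.mem_iff, Sym2.mem_iff]
  have := hz z
  grind

open Classical in
-- The vertices `u` and `v` have deficits 2 and 1. An edge avoiding `u` has total deficit at most 1
-- at its ends, so its merged exponent is at least 3 and the term dies. An edge at `u` uses up two
-- units of deficit and leaves the unit at the component of `v`, also when that edge is `uv`.
theorem sum_edgeGen_eq_d (num : G.edgeSet ↪ ℕ) {u v : V} (huv : u ≠ v) :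
    ∑ w, edgeGen G u w v = d G ℤ (TruncPoly 3) num 0
      (vertexMono G fun z => if z = u then 0 else if z = v then 1 else 2) := by
  funext t
  obtain ⟨e, ht⟩ := Finset.card_eq_one.1 t.2
  rw [Finset.sum_apply]
  simp only [edgeGen_apply ht]
  by_cases hu : u ∈ e.1
  · obtain ⟨y, he⟩ := hu
    rw [d_vertexMono_eq_nearTop num ht he v]
    · simp only [he, Sym2.congr_right]
      simp
    · have hy : y ≠ u := (SimpleGraph.Adj.ne (he ▸ e.2 : s(u, y) ∈ G.edgeSet)).symm
      grind
    · intro z hz _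
      simp [hz]
  · obtain ⟨⟨x, y⟩, hxy⟩ := e
    have hne : x ≠ y := SimpleGraph.Adj.ne hxy
    have hu' : u ≠ x ∧ u ≠ y := by simpa using hu
    rw [d_vertexMono_eq_zero num ht rfl]
    · refine Finset.sum_eq_zero fun w _ => if_neg fun h => hu ?_
      rw [h]
      exact Sym2.mem_mk_left _ _
    · grind

open Classical in
-- Three vertices have deficit 1 each. A merged factor survives only if both ends of the edge have
-- positive deficit, that is, on a side of the triangle; the unit left over sits at the opposite
-- vertex.
theorem edgeGen_cyclic_eq_d (num : G.edgeSet ↪ ℕ) {u v w : V} (huv : u ≠ v) (hvw : v ≠ w)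
    (hwu : w ≠ u) :
    edgeGen G u v w + edgeGen G v w u + edgeGen G w u v = d G ℤ (TruncPoly 3) num 0
      (vertexMono G fun z => if z = u then 1 else if z = v then 1 else if z = w then 1 else 2) := by
  funext t
  obtain ⟨e, ht⟩ := Finset.card_eq_one.1 t.2
  simp only [Pi.add_apply, edgeGen_apply ht]
  have key : ∀ a b c : V, a ≠ b → b ≠ c → c ≠ a → e.1 = s(a, b) →
      (∀ z, (z = u ∨ z = v ∨ z = w) ↔ (z = a ∨ z = b ∨ z = c)) →
      d G ℤ (TruncPoly 3) num 0 (vertexMono G fun z =>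
        if z = u then 1 else if z = v then 1 else if z = w then 1 else 2) t =
          nearTop (comp t.1 c) := by
    intro a b c hab hbc hca he h
    refine d_vertexMono_eq_nearTop num ht he c ?_ ?_
    · have h1 := h a
      have h2 := h b
      grind
    · intro z hza hzb
      have h1 := h z
      grind
  by_cases h1 : e.1 = s(u, v)
  · have h2 : e.1 ≠ s(v, w) := by rw [h1]; grind
    have h3 : e.1 ≠ s(w, u) := by rw [h1]; grind
    rw [key u v w huv hvw hwu h1 (by grind), if_pos h1, if_neg h2, if_neg h3, add_zero, add_zero]
  by_cases h2 : e.1 = s(v, w)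
  · have h3 : e.1 ≠ s(w, u) := by rw [h2]; grind
    rw [key v w u hvw hwu huv h2 (by grind), if_neg h1, if_pos h2, if_neg h3, add_zero, zero_add]
  by_cases h3 : e.1 = s(w, u)
  · rw [key w u v hwu huv hvw h3 (by grind), if_neg h1, if_neg h2, if_pos h3, zero_add, zero_add]
  rw [if_neg h1, if_neg h2, if_neg h3, add_zero, add_zero]
  obtain ⟨⟨x, y⟩, hxy⟩ := e
  have hne : x ≠ y := SimpleGraph.Adj.ne hxy
  change s(x, y) ≠ _ at h1 h2 h3
  rw [d_vertexMono_eq_zero num ht rfl]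
  grind

open Classical in
theorem exists_eq_add_single {ι : Type*} [Fintype ι] {D : ι → ℕ} {k : ℕ} (h : ∑ i, D i = k + 1) :
    ∃ (a : ι) (D' : ι → ℕ), (∀ i, D i = D' i + if i = a then 1 else 0) ∧ ∑ i, D' i = k := by
  obtain ⟨a, ha⟩ : ∃ a, D a ≠ 0 := by
    by_contra! hcon
    simp [hcon] at h
  have hD : ∀ i, D i = (D i - if i = a then 1 else 0) + if i = a then 1 else 0 := by
    intro i
    split_ifs with hi
    · subst hi; omega
    · simp
  refine ⟨a, fun i => D i - if i = a then 1 else 0, hD, ?_⟩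
  have h2 := Finset.sum_congr rfl fun i (_ : i ∈ Finset.univ) => hD i
  rw [Finset.sum_add_distrib, Finset.sum_ite_eq' Finset.univ a, h] at h2
  simp only [Finset.mem_univ, if_true] at h2
  change ∑ i, (D i - if i = a then 1 else 0) = k
  omega

open Classical in
-- Three units of deficit are peeled off one at a time and sorted by which of their positions
-- coincide.
theorem exists_of_sum_deficit {w : V → ℕ} (hw : ∀ v, w v ≤ 2)
    (hs : ∑ v, w v + 3 = 2 * Fintype.card V) :
    (∃ u v, u ≠ v ∧ w = fun z => if z = u then 0 else if z = v then 1 else 2) ∨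
    ∃ u v x, u ≠ v ∧ v ≠ x ∧ x ≠ u ∧
      w = fun z => if z = u then 1 else if z = v then 1 else if z = x then 1 else 2 := by
  have hD : ∑ v, (2 - w v) = 2 + 1 := by
    have h2 : ∑ v, (2 - w v) + ∑ v, w v = 2 * Fintype.card V := by
      rw [← Finset.sum_add_distrib, Finset.sum_congr rfl fun v _ => Nat.sub_add_cancel (hw v)]
      simp [mul_comm]
    omega
  obtain ⟨a, D1, h1, hs1⟩ := exists_eq_add_single hD
  obtain ⟨b, D2, h2, hs2⟩ := exists_eq_add_single hs1
  obtain ⟨c, D3, h3, hs3⟩ := exists_eq_add_single hs2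
  have h0 : ∀ v, D3 v = 0 := fun v => Finset.sum_eq_zero_iff.1 hs3 v (Finset.mem_univ v)
  have key : ∀ v, 2 - w v =
      ((if v = c then 1 else 0) + if v = b then 1 else 0) + if v = a then 1 else 0 := by
    intro v
    rw [h1, h2, h3, h0, zero_add]
  clear h1 h2 h3 h0 hs hD hs1 hs2 hs3
  by_cases hab : a = b
  · subst hab
    by_cases hac : a = c
    · subst hac
      -- All three units at one vertex would make `2 - w a` equal to 3.
      have := key a
      simp at this
      omega
    · refine Or.inl ⟨a, c, hac, funext fun z => ?_⟩
      have := key z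
      have := hw z
      grind
  by_cases hbc : b = c
  · subst hbc
    refine Or.inl ⟨b, a, Ne.symm hab, funext fun z => ?_⟩
    have := key z
    have := hw z
    grind
  by_cases hac : a = c
  · subst hac
    refine Or.inl ⟨a, b, hab, funext fun z => ?_⟩
    have := key z
    have := hw z
    grind
  refine Or.inr ⟨a, b, c, hab, hbc, Ne.symm hac, funext fun z => ?_⟩
  have := key z
  have := hw z
  grind

open Classical in
theorem sum_deficit_pair {u v : V} (huv : u ≠ v) :
    ∑ z, (if z = u then 0 else if z = v then 1 else 2) + 3 = 2 * Fintype.card V := by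
  have h : ∑ z : V, ((if z = u then 0 else if z = v then 1 else 2) +
      ((if z = u then 2 else 0) + if z = v then 1 else 0)) = 2 * Fintype.card V := by
    rw [Finset.sum_congr rfl (g := fun _ => 2) fun z _ => by grind]
    simp [mul_comm]
  rw [Finset.sum_add_distrib, Finset.sum_add_distrib, Finset.sum_ite_eq' Finset.univ u,
    Finset.sum_ite_eq' Finset.univ v] at h
  simpa using h

open Classical in
theorem sum_deficit_triple {u v w : V} (huv : u ≠ v) (hvw : v ≠ w) (hwu : w ≠ u) :
    ∑ z, (if z = u then 1 else if z = v then 1 else if z = w then 1 else 2) + 3 =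
      2 * Fintype.card V := by
  have h : ∑ z : V, ((if z = u then 1 else if z = v then 1 else if z = w then 1 else 2) +
      ((if z = u then 1 else 0) + ((if z = v then 1 else 0) + if z = w then 1 else 0))) =
        2 * Fintype.card V := by
    rw [Finset.sum_congr rfl (g := fun _ => 2) fun z _ => by grind]
    simp [mul_comm]
  rw [Finset.sum_add_distrib, Finset.sum_add_distrib, Finset.sum_add_distrib,
    Finset.sum_ite_eq' Finset.univ u, Finset.sum_ite_eq' Finset.univ v,
    Finset.sum_ite_eq' Finset.univ w] at h
  simpa using h

end Relations

/-! ### Presentation of the first cohomology group by edge systems -/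

section Presentation

variable {V : Type*} [Fintype V]

/-- The relations between the classes of the cochains `edgeGen G u v w` in the first cohomology
group in degree `2|V| - 3`. -/
structure IsEdgeSystem (G : SimpleGraph V) {B : Type*} [AddCommGroup B] (p : V → V → V → B) :
    Prop where
  comm : ∀ u v w, p u v w = p v u w
  left_eq_right : ∀ u v, p u v u = p u v v
  eq_zero : ∀ u v, ¬ G.Adj u v → ∀ w, p u v w = 0
  sum_eq_zero : ∀ u v, u ≠ v → ∑ w, p u w v = 0
  cyclic : ∀ u v w, u ≠ v → v ≠ w → w ≠ u → p u v w + p v w u + p w u v = 0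

open Classical in
-- The near-top coefficients at each state are paired with the values of `p`. Only `comm`,
-- `left_eq_right` and `eq_zero` matter here: they express the coincidences among the `edgeGen`. The
-- other two relations are needed only to kill coboundaries.
theorem exists_hom_cochain {G : SimpleGraph V} {B : Type*} [AddCommGroup B] {p : V → V → V → B}
    (hp : IsEdgeSystem G p) :
    ∃ f : Cochain G ℤ (TruncPoly 3) 1 →ₗ[ℤ] B, ∀ u v w, f (edgeGen G u v w) = p u v w := by
  have hfin : Finite G.edgeSet := inferInstance
  have := Fintype.ofFinite G.edgeSet
  have hex : ∀ t : {s : Finset G.edgeSet // s.card = 1}, ∃ x y : V, ∃ h : s(x, y) ∈ G.edgeSet,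
      t.1 = {⟨s(x, y), h⟩} := by
    intro t
    obtain ⟨e, ht⟩ := Finset.card_eq_one.1 t.2
    obtain ⟨⟨x, y⟩, hxy⟩ := e
    exact ⟨x, y, hxy, ht⟩
  choose a b hab hs using hex
  -- The value depends neither on the order chosen for the ends of the edge nor on the vertex chosen
  -- in the component.
  have hval : ∀ t u v w, s(a t, b t) = s(u, v) → p (a t) (b t) (rep (comp t.1 w)) = p u v w := by
    intro t u v w h
    have h1 : p (a t) (b t) (rep (comp t.1 w)) = p (a t) (b t) w := by
      rcases (comp_eq_comp_of_eq_singleton (hs t)).1 (comp_rep (comp t.1 w)) with h | ⟨h1, h2⟩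
      · rw [h]
      · have key : ∀ z ∈ s(a t, b t), p (a t) (b t) z = p (a t) (b t) (a t) := by
          intro z hz
          rcases Sym2.mem_iff.1 hz with rfl | rfl
          · rfl
          · exact (hp.left_eq_right _ _).symm
        rw [key _ h1, key _ h2]
    rw [h1]
    rcases Sym2.eq_iff.1 h with ⟨rfl, rfl⟩ | ⟨rfl, rfl⟩
    · rfl
    · exact hp.comm _ _ _
  refine ⟨∑ t : {s : Finset G.edgeSet // s.card = 1}, ∑ c : StateComponent G t.1,
    LinearMap.toSpanSingleton ℤ B (p (a t) (b t) (rep c)) ∘ₗ nearTopCoeff c ∘ₗ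
      LinearMap.proj t, fun u v w => ?_⟩
  simp only [LinearMap.sum_apply, LinearMap.comp_apply, LinearMap.proj_apply,
    LinearMap.toSpanSingleton_apply]
  have hterm : ∀ t : {s : Finset G.edgeSet // s.card = 1},
      ∑ c : StateComponent G t.1, nearTopCoeff c (edgeGen G u v w t) • p (a t) (b t) (rep c) =
        if s(a t, b t) = s(u, v) then p u v w else 0 := by
    intro t
    rw [edgeGen_apply (hs t)]
    split_ifs with h
    · simp only [nearTopCoeff_nearTop, ite_smul, one_smul, zero_smul]
      rw [Finset.sum_ite_eq' Finset.univ (comp t.1 w), if_pos (Finset.mem_univ _), hval t u v w h]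
    · simp
  rw [Finset.sum_congr rfl fun t _ => hterm t]
  by_cases huv : G.Adj u v
  · let t₀ : {s : Finset G.edgeSet // s.card = 1} :=
      ⟨{(⟨s(u, v), huv⟩ : G.edgeSet)}, Finset.card_singleton _⟩
    have ht₀ : ∀ t, s(a t, b t) = s(u, v) ↔ t = t₀ := by
      intro t
      rw [← Subtype.coe_inj, hs t, Finset.singleton_inj]
      exact ⟨fun h => Subtype.ext h, fun h => congrArg Subtype.val h⟩
    simp only [ht₀]
    rw [Finset.sum_ite_eq' Finset.univ t₀, if_pos (Finset.mem_univ _)]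
  · rw [hp.eq_zero u v huv w]
    simp

theorem hom_d_eq_zero {G : SimpleGraph V} {B : Type*} [AddCommGroup B] {p : V → V → V → B}
    (hp : IsEdgeSystem G p) (num : G.edgeSet ↪ ℕ) {j : ℕ} (hj : j + 3 = 2 * Fintype.card V)
    {f : Cochain G ℤ (TruncPoly 3) 1 →ₗ[ℤ] B} (hf : ∀ u v w, f (edgeGen G u v w) = p u v w)
    {x : Cochain G ℤ (TruncPoly 3) 0} (hx : x ∈ cochainDegree G ℤ (truncGrading 3) 0 j) :
    f (d G ℤ (TruncPoly 3) num 0 x) = 0 := by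
  classical
  suffices h : cochainDegree G ℤ (truncGrading 3) 0 j ≤
      LinearMap.ker (f ∘ₗ d G ℤ (TruncPoly 3) num 0) from h hx
  refine (cochainDegree_zero_le j).trans (Submodule.span_le.2 ?_)
  rintro _ ⟨w, hw, hs, rfl⟩
  rw [SetLike.mem_coe, LinearMap.mem_ker, LinearMap.comp_apply]
  rcases exists_of_sum_deficit hw (by omega) with ⟨u, v, huv, rfl⟩ | ⟨u, v, x, h1, h2, h3, rfl⟩
  · rw [← sum_edgeGen_eq_d num huv, map_sum]
    simp only [hf]
    exact hp.sum_eq_zero u v huv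
  · rw [← edgeGen_cyclic_eq_d num h1 h2 h3, map_add, map_add, hf, hf, hf]
    exact hp.cyclic u v x h1 h2 h3

/-- The first cohomology group over `ℤ[x]/(x^3)` in degree `2|V| - 3` is presented by the
generators `edgeGen G u v w` and the relations of `IsEdgeSystem`. -/
theorem exists_universal_edgeSystem (G : SimpleGraph V) (num : G.edgeSet ↪ ℕ) {j : ℕ}
    (hj : j + 3 = 2 * Fintype.card V) :
    ∃ g : V → V → V → TruncCohomology 3 G num 1 j, IsEdgeSystem G g ∧
      AddSubgroup.closure {x | ∃ u v w, g u v w = x} = ⊤ ∧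
      ∀ (B : Type) [AddCommGroup B] (p : V → V → V → B), IsEdgeSystem G p →
        ∃ f : TruncCohomology 3 G num 1 j →+ B, ∀ u v w, f (g u v w) = p u v w := by
  classical
  have hcoc : cocycles G ℤ (truncGrading 3) num 1 j = cochainDegree G ℤ (truncGrading 3) 1 j :=
    inf_eq_left.2 (cochainDegree_one_le_ker_d num hj)
  have hmem : ∀ u v w, edgeGen G u v w ∈ cocycles G ℤ (truncGrading 3) num 1 j :=
    fun u v w => hcoc ▸ edgeGen_mem_cochainDegree hj u v w
  let g' : V → V → V → cocycles G ℤ (truncGrading 3) num 1 j :=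
    fun u v w => ⟨edgeGen G u v w, hmem u v w⟩
  let K := (coboundaries G ℤ (truncGrading 3) num 1 j).submoduleOf
    (cocycles G ℤ (truncGrading 3) num 1 j)
  have hspan : Submodule.span ℤ {x | ∃ u v w, g' u v w = x} = ⊤ := by
    rw [eq_top_iff]
    rintro ⟨x, hx⟩ -
    have hx' := cochainDegree_one_le hj (hcoc ▸ hx)
    have himg : {x | ∃ u v w, edgeGen G u v w = x} =
        (cocycles G ℤ (truncGrading 3) num 1 j).subtype '' {x | ∃ u v w, g' u v w = x} := by
      ext y
      constructor
      · rintro ⟨u, v, w, rfl⟩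
        exact ⟨_, ⟨u, v, w, rfl⟩, rfl⟩
      · rintro ⟨_, ⟨u, v, w, rfl⟩, rfl⟩
        exact ⟨u, v, w, rfl⟩
    rw [himg, ← Submodule.map_span] at hx'
    obtain ⟨y, hy, hyx⟩ := hx'
    obtain rfl : y = ⟨x, hx⟩ := Subtype.ext hyx
    exact hy
  refine ⟨fun u v w => K.mkQ (g' u v w), ⟨?_, ?_, ?_, ?_, ?_⟩, ?_, ?_⟩
  · exact fun u v w => congrArg K.mkQ (Subtype.ext (edgeGen_comm u v w))
  · exact fun u v => congrArg K.mkQ (Subtype.ext (edgeGen_left_eq_right u v))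
  · intro u v h w
    rw [show g' u v w = 0 from Subtype.ext (edgeGen_eq_zero h w), map_zero]
  · intro u v huv
    rw [← map_sum, ← LinearMap.mem_ker, Submodule.ker_mkQ]
    change ((∑ w, g' u w v : cocycles G ℤ (truncGrading 3) num 1 j) :
      Cochain G ℤ (TruncPoly 3) 1) ∈ coboundaries G ℤ (truncGrading 3) num 1 j
    rw [Submodule.coe_sum]
    change ∑ w, edgeGen G u w v ∈ _
    rw [sum_edgeGen_eq_d num huv]
    exact Submodule.mem_map_of_mem (vertexMono_mem_cochainDegree
      (by have := sum_deficit_pair huv; omega))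
  · intro u v w h1 h2 h3
    rw [← map_add, ← map_add, ← LinearMap.mem_ker, Submodule.ker_mkQ]
    change edgeGen G u v w + edgeGen G v w u + edgeGen G w u v ∈
      coboundaries G ℤ (truncGrading 3) num 1 j
    rw [edgeGen_cyclic_eq_d num h1 h2 h3]
    exact Submodule.mem_map_of_mem (vertexMono_mem_cochainDegree
      (by have := sum_deficit_triple h1 h2 h3; omega))
  · have h := congrArg (Submodule.map K.mkQ) hspan
    rw [Submodule.map_top, Submodule.range_mkQ, Submodule.map_span] at h
    have himg : K.mkQ '' {x | ∃ u v w, g' u v w = x} = {x | ∃ u v w, K.mkQ (g' u v w) = x} := by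
      ext y
      constructor
      · rintro ⟨_, ⟨u, v, w, rfl⟩, rfl⟩
        exact ⟨u, v, w, rfl⟩
      · rintro ⟨u, v, w, rfl⟩
        exact ⟨_, ⟨u, v, w, rfl⟩, rfl⟩
    rw [himg] at h
    rw [← Submodule.span_int_eq_addSubgroupClosure, h, Submodule.top_toAddSubgroup]
  · intro B _ p hp
    obtain ⟨f, hf⟩ := exists_hom_cochain hp
    -- The homomorphism on cochains kills coboundaries, so it descends to the quotient.
    have hK : K ≤ LinearMap.ker (f ∘ₗ (cocycles G ℤ (truncGrading 3) num 1 j).subtype) := by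
      rintro ⟨x, hx⟩ hxK
      obtain ⟨y, hy, rfl⟩ : x ∈ (cochainDegree G ℤ (truncGrading 3) 0 j).map
        (d G ℤ (TruncPoly 3) num 0) := hxK
      exact hom_d_eq_zero hp num hj hf hy
    exact ⟨(K.liftQ _ hK).toAddMonoidHom, fun u v w => hf u v w⟩

end Presentation

/-! ### The standard edge system of a wheel -/

section WheelSystem

variable {Z T : Type*} [AddCommGroup Z] [DecidableEq Z] [AddCommGroup T]

/-- The value of the standard edge system of a wheel at a rim edge `{i, i + o}` and a rim
vertex `j`. -/
def rimValue (o : Z) (α ρ : Z → T) (i j : Z) : T :=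
  (if j = i + o + o then ρ (i + o) else 0) - (if i = j + o then ρ i else 0) +
    (if j = i then ρ (i + o) - ρ i - α i else 0) + (if j = i + o then ρ (i + o) - ρ i - α i else 0)

/-- The value of the standard edge system of a wheel at a rim edge `{i, i + o}` and the hub. -/
def hubValue (o : Z) (α ρ : Z → T) (i : Z) : T := ρ (i + o) - ρ i - (2 : ℤ) • α i

/-- The value of the standard edge system of a wheel at the contraction of the spoke to `i`. -/
def spokeValue (o : Z) (α ρ : Z → T) (i : Z) : T :=
  -(hubValue o α ρ i + hubValue o α ρ (i - o))

/-- The standard edge system of a wheel with hub `none`, whose rim is the Cayley graph of `Z` with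
respect to a generator `o`. -/
def wheelSystem (o : Z) (α ρ : Z → T) : Option Z → Option Z → Option Z → T
  | some i, some k, some j =>
      (if k = i + o then rimValue o α ρ i j else 0) + if i = k + o then rimValue o α ρ k j else 0
  | some i, some k, none =>
      (if k = i + o then hubValue o α ρ i else 0) + if i = k + o then hubValue o α ρ k else 0
  | none, some i, some j =>
      if i = j then spokeValue o α ρ i else -rimValue o α ρ (i - o) j - rimValue o α ρ i j
  | some i, none, some j =>
      if i = j then spokeValue o α ρ i else -rimValue o α ρ (i - o) j - rimValue o α ρ i j
  | none, some i, none => spokeValue o α ρ i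
  | some i, none, none => spokeValue o α ρ i
  | none, none, _ => 0

variable {o : Z} {α ρ : Z → T}

theorem rimValue_self (h1 : o ≠ 0) (h2 : o + o ≠ 0) (i : Z) :
    rimValue o α ρ i i = ρ (i + o) - ρ i - α i := by
  have e1 : i ≠ i + o + o := fun h => h2 (by rw [add_assoc] at h; exact left_eq_add.1 h)
  have e2 : i ≠ i + o := fun h => h1 (left_eq_add.1 h)
  simp [rimValue, e1, e2]

theorem rimValue_succ (h1 : o ≠ 0) (h2 : o + o ≠ 0) (i : Z) :
    rimValue o α ρ i (i + o) = ρ (i + o) - ρ i - α i := by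
  have e1 : i ≠ i + o + o := fun h => h2 (by rw [add_assoc] at h; exact left_eq_add.1 h)
  simp [rimValue, h1, e1]

theorem wheelSystem_comm (u v w : Option Z) :
    wheelSystem o α ρ u v w = wheelSystem o α ρ v u w := by
  rcases u with _ | i <;> rcases v with _ | k <;> rcases w with _ | j <;>
    simp only [wheelSystem, add_comm]

theorem sum_rimValue [Fintype Z] (j : Z) :
    ∑ i, rimValue o α ρ i j = ρ (j - o) - ρ (j + o) + (ρ (j + o) - ρ j - α j) +
      (ρ j - ρ (j - o) - α (j - o)) := by
  have e1 : ∀ i, j = i + o + o ↔ i = j - o - o := fun i => by grind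
  have e2 : ∀ i, j = i + o ↔ i = j - o := fun i => by grind
  have e3 : ∀ i, j = i ↔ i = j := fun i => eq_comm
  unfold rimValue
  simp only [Finset.sum_add_distrib, Finset.sum_sub_distrib, e1]
  simp only [e2]
  simp only [e3]
  simp [sub_add_cancel]

theorem rimValue_sub (i j : Z) :
    rimValue o α ρ (i - o) j = (if j = i + o then ρ i else 0) -
      (if i = j + o + o then ρ (j + o) else 0) + (if i = j + o then ρ i - ρ j - α j else 0) +
        if j = i then ρ i - ρ (i - o) - α (i - o) else 0 := by
  have e1 : i - o = j + o ↔ i = j + o + o := sub_eq_iff_eq_add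
  have e2 : j = i - o ↔ i = j + o := eq_sub_iff_add_eq.trans eq_comm
  simp only [rimValue, sub_add_cancel, e1, e2]
  congr 2
  · congr 1
    split_ifs with h
    · rw [e1.2 h]
    · rfl
  · split_ifs with h
    · rw [e2.2 h]
    · rfl

theorem wheelSystem_cyclic_hub {i j : Z} (hij : i ≠ j) :
    wheelSystem o α ρ none (some i) (some j) + wheelSystem o α ρ (some i) (some j) none +
      wheelSystem o α ρ (some j) none (some i) = 0 := by
  simp only [wheelSystem, if_neg hij, if_neg hij.symm, rimValue_sub]
  simp only [rimValue, hubValue, if_neg hij, if_neg hij.symm, add_zero]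
  -- Where the indicator is nonzero, `ρ (i + o) = ρ j`. The hub value is split into the two diagonal
  -- terms and the two path terms of the rim values, so that everything cancels formally.
  have h1 : (if j = i + o then ρ (i + o) - ρ i - (2 : ℤ) • α i else 0) =
      (if j = i + o then ρ j - ρ i - α i else 0) + (if j = i + o then ρ (i + o) - ρ i - α i else 0) -
        (if j = i + o then ρ j else 0) + if j = i + o then ρ i else 0 := by
    split_ifs with h
    · rw [h]; module
    · simp
  have h2 : (if i = j + o then ρ (j + o) - ρ j - (2 : ℤ) • α j else 0) =
      (if i = j + o then ρ i - ρ j - α j else 0) + (if i = j + o then ρ (j + o) - ρ j - α j else 0) -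
        (if i = j + o then ρ i else 0) + if i = j + o then ρ j else 0 := by
    split_ifs with h
    · rw [h]; module
    · simp
  rw [h1, h2]
  abel

theorem wheelSystem_cyclic_rim (h2 : o + o ≠ 0) {i j k : Z} (hij : i ≠ j)
    (hjk : j ≠ k) (hki : k ≠ i) :
    wheelSystem o α ρ (some i) (some j) (some k) + wheelSystem o α ρ (some j) (some k) (some i) +
      wheelSystem o α ρ (some k) (some i) (some j) = 0 := by
  simp only [wheelSystem, rimValue]
  grind

/-- All values are integral combinations of the parameters; hence `α` and `ρ` generate whatever the
edge system generates. -/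
theorem wheelSystem_mem {α ρ : Z → T} {S : AddSubgroup T} (hα : ∀ i, α i ∈ S) (hρ : ∀ i, ρ i ∈ S)
    (u v w : Option Z) : wheelSystem o α ρ u v w ∈ S := by
  have hite : ∀ (p : Prop) [Decidable p] (x : T), x ∈ S → (if p then x else 0) ∈ S := by
    intro p _ x hx
    split_ifs
    · exact hx
    · exact S.zero_mem
  have hrim : ∀ i j, rimValue o α ρ i j ∈ S := by
    intro i j
    have h := S.sub_mem (S.sub_mem (hρ (i + o)) (hρ i)) (hα i)
    exact S.add_mem (S.add_mem (S.sub_mem (hite _ _ (hρ _)) (hite _ _ (hρ _))) (hite _ _ h))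
      (hite _ _ h)
  have hhub : ∀ i, hubValue o α ρ i ∈ S := fun i =>
    S.sub_mem (S.sub_mem (hρ _) (hρ _)) (S.zsmul_mem (hα i) 2)
  have hspoke : ∀ i, spokeValue o α ρ i ∈ S := fun i =>
    S.neg_mem (S.add_mem (hhub i) (hhub _))
  have hsr : ∀ i j, (if i = j then spokeValue o α ρ i else
      -rimValue o α ρ (i - o) j - rimValue o α ρ i j) ∈ S := by
    intro i j
    split_ifs
    · exact hspoke i
    · exact S.sub_mem (S.neg_mem (hrim _ _)) (hrim _ _)
  rcases u with _ | i <;> rcases v with _ | k <;> rcases w with _ | j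
  · exact S.zero_mem
  · exact S.zero_mem
  · exact hspoke k
  · exact hsr k j
  · exact hspoke i
  · exact hsr i j
  · exact S.add_mem (hite _ _ (hhub _)) (hite _ _ (hhub _))
  · exact S.add_mem (hite _ _ (hrim _ _)) (hite _ _ (hrim _ _))

/-- The hypothesis `h3` excludes a triangular rim, on which the value would be `ρ i - ρ (i - o)`. -/
theorem wheelSystem_rim_path {α ρ : Z → T} (h2 : o + o ≠ 0) (h3 : o + o + o ≠ 0) (i : Z) :
    wheelSystem o α ρ (some (i - o)) (some i) (some (i + o)) = ρ i := by
  simp only [wheelSystem, rimValue]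
  grind

theorem wheelSystem_rim_self {α ρ : Z → T} (h1 : o ≠ 0) (h2 : o + o ≠ 0) (i : Z) :
    wheelSystem o α ρ (some i) (some (i + o)) (some i) = ρ (i + o) - ρ i - α i := by
  have e : ¬ i = i + o + o := fun h => h2 (by rw [add_assoc] at h; exact left_eq_add.1 h)
  simp only [wheelSystem, if_true, if_neg e, add_zero, rimValue_self h1 h2]

theorem sum_ite_rim_neighbors [Fintype Z] (i : Z) (a : T) (f : Z → T) :
    ∑ k, ((if k = i + o then a else 0) + if i = k + o then f k else 0) = a + f (i - o) := by
  have e : ∀ k : Z, i = k + o ↔ k = i - o := fun k => eq_comm.trans eq_sub_iff_add_eq.symm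
  rw [Finset.sum_add_distrib, Finset.sum_ite_eq' Finset.univ (i + o), if_pos (Finset.mem_univ _)]
  simp only [e]
  rw [Finset.sum_ite_eq' Finset.univ (i - o), if_pos (Finset.mem_univ _)]

/-- All `ρ` cancel. The coefficient of `α (j - o) + α j` is `2 - 1 + 2`: from the spoke to `j`, from
the diagonal correction, and from twice the sum of the rim values at `j`. -/
theorem sum_wheelSystem_hub [Fintype Z] (h1 : o ≠ 0) (h2 : o + o ≠ 0) (j : Z) :
    ∑ w, wheelSystem o α ρ none w (some j) = (3 : ℤ) • (α (j - o) + α j) := by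
  rw [Fintype.sum_option]
  simp only [wheelSystem, zero_add]
  -- The off-diagonal formula is extended to `i = j` at the price of a correction term there.
  have h : ∀ i, (if i = j then spokeValue o α ρ i else
      -rimValue o α ρ (i - o) j - rimValue o α ρ i j) =
      (if i = j then spokeValue o α ρ i + rimValue o α ρ (i - o) j + rimValue o α ρ i j
        else 0) - rimValue o α ρ (i - o) j - rimValue o α ρ i j := by
    intro i
    split_ifs <;> abel
  have hshift : ∑ i, rimValue o α ρ (i - o) j = ∑ i, rimValue o α ρ i j :=
    (Equiv.subRight o).sum_comp fun i => rimValue o α ρ i j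
  rw [Finset.sum_congr rfl fun i _ => h i, Finset.sum_sub_distrib, Finset.sum_sub_distrib,
    Finset.sum_ite_eq' Finset.univ j, if_pos (Finset.mem_univ _),
    hshift, sum_rimValue,
    rimValue_self h1 h2, spokeValue, hubValue, hubValue, sub_add_cancel]
  have h3 := rimValue_succ (α := α) (ρ := ρ) h1 h2 (j - o)
  rw [sub_add_cancel] at h3
  rw [h3]
  module

theorem isEdgeSystem_wheelSystem [Fintype Z] {G : SimpleGraph (Option Z)} (h1 : o ≠ 0)
    (h2 : o + o ≠ 0) (hG : ∀ i, G.Adj none (some i))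
    (hG' : ∀ i k, k = i + o ∨ i = k + o → G.Adj (some i) (some k))
    (hα : ∀ i, (3 : ℤ) • (α (i - o) + α i) = 0) : IsEdgeSystem G (wheelSystem o α ρ) where
  comm := wheelSystem_comm
  left_eq_right u v := by
    rcases u with _ | i <;> rcases v with _ | k
    · rfl
    · simp [wheelSystem]
    · simp [wheelSystem]
    · simp only [wheelSystem]
      by_cases h : k = i + o
      · subst h
        have e : ¬ i = i + o + o := fun h => h2 (by rw [add_assoc] at h; exact left_eq_add.1 h)
        simp only [if_true, if_neg e, add_zero, rimValue_self h1 h2, rimValue_succ h1 h2]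
      · by_cases h' : i = k + o
        · subst h'
          simp only [if_true, if_neg h, zero_add, rimValue_self h1 h2, rimValue_succ h1 h2]
        · simp only [if_neg h, if_neg h']
  eq_zero u v huv w := by
    rcases u with _ | i <;> rcases v with _ | k
    · rfl
    · exact absurd (hG k) huv
    · exact absurd (hG i).symm huv
    · have h : ¬ (k = i + o ∨ i = k + o) := fun h => huv (hG' i k h)
      rw [not_or] at h
      rcases w with _ | j <;> simp [wheelSystem, h.1, h.2]
  sum_eq_zero u v huv := by
    rcases u with _ | i <;> rcases v with _ | j
    · exact absurd rfl huv
    · rw [sum_wheelSystem_hub h1 h2, hα]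
    · rw [Fintype.sum_option]
      simp only [wheelSystem]
      rw [sum_ite_rim_neighbors, spokeValue, neg_add_cancel]
    · have hij : i ≠ j := fun h => huv (congrArg some h)
      rw [Fintype.sum_option]
      simp only [wheelSystem, if_neg hij]
      rw [sum_ite_rim_neighbors i (rimValue o α ρ i j) fun k => rimValue o α ρ k j]
      abel
  cyclic u v w h1' h2' h3' := by
    rcases u with _ | i <;> rcases v with _ | k <;> rcases w with _ | j
    · exact absurd rfl h1'
    · exact absurd rfl h1'
    · exact absurd rfl h3'
    · exact wheelSystem_cyclic_hub fun h => h2' (congrArg some h)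
    · exact absurd rfl h2'
    · rw [← wheelSystem_cyclic_hub (o := o) (α := α) (ρ := ρ) (i := j) (j := i)
        fun h => h3' (congrArg some h)]
      abel
    · rw [← wheelSystem_cyclic_hub (o := o) (α := α) (ρ := ρ) (i := i) (j := k)
        fun h => h1' (congrArg some h)]
      abel
    · exact wheelSystem_cyclic_rim h2 (fun h => h1' (congrArg some h))
        (fun h => h2' (congrArg some h)) fun h => h3' (congrArg some h)

end WheelSystem

/-! ### Every edge system of a wheel is standard -/

section WheelSystem

variable {Z T : Type*} [AddCommGroup Z] [DecidableEq Z] [AddCommGroup T] [Fintype Z] {o : Z}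

/-- The hypotheses fix the values at rim edges and rim vertices. The star relation at a rim vertex
`i` then gives the spoke to `i` at other rim vertices, the cyclic relation through the hub gives rim
edges at the hub, and the star relation at `i` with the hub marked gives the spoke at its own
component. -/
theorem IsEdgeSystem.eq_wheelSystem {G : SimpleGraph (Option Z)} 
    {g : Option Z → Option Z → Option Z → T}
    (hg : IsEdgeSystem G g) (h1 : o ≠ 0) (h2 : o + o ≠ 0)
    (hG : ∀ i k, G.Adj (some i) (some k) → k = i + o ∨ i = k + o) {α ρ : Z → T}
    (hα : ∀ i, α i = ρ (i + o) - ρ i - g (some i) (some (i + o)) (some i))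
    (hρ : ∀ i j, j ≠ i → j ≠ i + o → g (some i) (some (i + o)) (some j) =
      (if j = i + o + o then ρ (i + o) else 0) - if i = j + o then ρ i else 0) :
    g = wheelSystem o α ρ := by
  have hrim : ∀ i j, g (some i) (some (i + o)) (some j) = rimValue o α ρ i j := by
    intro i j
    by_cases hi : j = i
    · rw [hi, rimValue_self h1 h2, hα]
      abel
    by_cases hi' : j = i + o
    · rw [hi', rimValue_succ h1 h2, hα, ← hg.left_eq_right]
      abel
    rw [hρ i j hi hi', rimValue, if_neg hi, if_neg hi', add_zero, add_zero]
  have hnot : ∀ i : Z, ¬ i = i + o + o := fun i h =>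
    h2 (by rw [add_assoc] at h; exact left_eq_add.1 h)
  have hrr : ∀ i k j, g (some i) (some k) (some j) =
      wheelSystem o α ρ (some i) (some k) (some j) := by
    intro i k j
    simp only [wheelSystem]
    by_cases h : k = i + o
    · subst h
      rw [hrim, if_pos rfl, if_neg (hnot i), add_zero]
    by_cases h' : i = k + o
    · subst h'
      rw [hg.comm, hrim, if_pos rfl, if_neg h, zero_add]
    rw [hg.eq_zero _ _ fun hadj => (hG i k hadj).elim h h', if_neg h, if_neg h', add_zero]
  have hspoke : ∀ i j, i ≠ j → g (some i) none (some j) =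
      wheelSystem o α ρ (some i) none (some j) := by
    intro i j hij
    have h := hg.sum_eq_zero (some i) (some j) fun h => hij (Option.some.inj h)
    rw [Fintype.sum_option] at h
    simp only [hrr, wheelSystem] at h
    rw [sum_ite_rim_neighbors i (rimValue o α ρ i j) fun k => rimValue o α ρ k j] at h
    simp only [wheelSystem, if_neg hij]
    rw [eq_neg_of_add_eq_zero_left h]
    abel
  have hrh : ∀ i k, g (some i) (some k) none = wheelSystem o α ρ (some i) (some k) none := by
    intro i k
    by_cases hik : i = k
    · subst hik
      have hadj : ¬ G.Adj (some i) (some i) := G.loopless.irrefl _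
      rw [hg.eq_zero _ _ hadj]
      simp [wheelSystem, h1]
    · have h := hg.cyclic none (some i) (some k) (by simp) (by simpa using hik) (by simp)
      rw [hg.comm none, hspoke i k hik, hspoke k i (Ne.symm hik), wheelSystem_comm,
        ← wheelSystem_cyclic_hub (o := o) (α := α) (ρ := ρ) hik] at h
      exact add_left_cancel (add_right_cancel h)
  have hhub : ∀ i, g (some i) none none = spokeValue o α ρ i := by
    intro i
    have h := hg.sum_eq_zero (some i) none (by simp)
    rw [Fintype.sum_option] at h
    simp only [hrh, wheelSystem] at h
    rw [sum_ite_rim_neighbors] at h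
    exact eq_neg_of_add_eq_zero_left h
  have hsr : ∀ i j, g (some i) none (some j) = wheelSystem o α ρ (some i) none (some j) := by
    intro i j
    by_cases hij : i = j
    · subst hij
      rw [hg.left_eq_right, hhub]
      simp [wheelSystem]
    · exact hspoke i j hij
  funext u v w
  rcases u with _ | i <;> rcases v with _ | k
  · exact hg.eq_zero _ _ (G.loopless.irrefl _) w
  · rw [hg.comm, wheelSystem_comm]
    rcases w with _ | j
    · exact hhub k
    · exact hsr k j
  · rcases w with _ | j
    · exact hhub i
    · exact hsr i j
  · rcases w with _ | j
    · exact hrh i k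
    · exact hrr i k j

theorem IsEdgeSystem.three_smul_eq_zero {G : SimpleGraph (Option Z)} {α ρ : Z → T}
    (hg : IsEdgeSystem G (wheelSystem o α ρ)) (h1 : o ≠ 0) (h2 : o + o ≠ 0) (i : Z) :
    (3 : ℤ) • (α (i - o) + α i) = 0 := by
  rw [← sum_wheelSystem_hub (ρ := ρ) h1 h2, hg.sum_eq_zero none (some i) (by simp)]

/-- In a wheel whose rim has at least four vertices, the parameters `ρ` of an edge system can be
read off the paths of length two in the rim. -/
theorem IsEdgeSystem.rim_path {G : SimpleGraph (Option Z)} 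
    {g : Option Z → Option Z → Option Z → T}
    (hg : IsEdgeSystem G g) (h1 : o ≠ 0) (h3 : o + o + o ≠ 0)
    (hG : ∀ i k, G.Adj (some i) (some k) → k = i + o ∨ i = k + o) {i j : Z} (hji : j ≠ i)
    (hji' : j ≠ i + o) : g (some i) (some (i + o)) (some j) =
      (if j = i + o + o then g (some (i + o - o)) (some (i + o)) (some (i + o + o)) else 0) -
        if i = j + o then g (some (i - o)) (some i) (some (i + o)) else 0 := by
  have hio : i ≠ i + o := fun h => h1 (left_eq_add.1 h)
  have h := hg.cyclic (some i) (some (i + o)) (some j) (by simpa using h1)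
    (by simpa using hji'.symm) (by simpa using hji)
  by_cases hj : j = i + o + o
  · have hne : ¬ i = j + o := by
      rw [hj]
      grind
    rw [if_pos hj, if_neg hne, sub_zero, add_sub_cancel_right, hj]
  · have h0 : g (some (i + o)) (some j) (some i) = 0 := by
      refine hg.eq_zero _ _ (fun hadj => ?_) _
      rcases hG _ _ hadj with h | h
      · exact hj h
      · exact hji (add_right_cancel h).symm
    rw [h0, add_zero] at h
    by_cases hj' : i = j + o
    · rw [if_neg hj, if_pos hj', zero_sub, eq_neg_of_add_eq_zero_left h, hj', add_sub_cancel_right]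
    · have h0' : g (some j) (some i) (some (i + o)) = 0 := by
        refine hg.eq_zero _ _ (fun hadj => ?_) _
        rcases hG _ _ hadj with h | h
        · exact hj' h
        · exact hji' h
      rw [h0', add_zero] at h
      rw [if_neg hj, if_neg hj', sub_zero, h]

end WheelSystem

/-! ### Generators and relations for the wheel -/

/-- The defining relations, in terms of two families of generators `α` and `ρ`, of the first
cohomology group of a wheel: `3(α_{i-1} + α_i) = 0`, and `ρ_0 = 0` if the rim is a triangle. -/
structure IsWheelPair (k : ℕ) {T : Type*} [AddCommGroup T] (α ρ : Fin (k + 3) → T) : Prop where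
  three_smul : ∀ i, (3 : ℤ) • (α (i - 1) + α i) = 0
  zero : k = 0 → ρ 0 = 0

/-- Edge systems and wheel pairs determine each other, so the universal property of the former
passes to the latter. The triangular rim needs its own choice of `ρ`, since a path of length two
does not isolate a single `ρ i` there. -/
theorem exists_wheelPair (k : ℕ)
    (num : (cone (SimpleGraph.cycleGraph (k + 3))).edgeSet ↪ ℕ) {j : ℕ} (hj : j + 3 = 2 * (k + 4)) :
    ∃ α ρ : Fin (k + 3) → TruncCohomology 3 (cone (SimpleGraph.cycleGraph (k + 3))) num 1 j,
      IsWheelPair k α ρ ∧ AddSubgroup.closure (Set.range α ∪ Set.range ρ) = ⊤ ∧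
      ∀ (B : Type) [AddCommGroup B] (α' ρ' : Fin (k + 3) → B), IsWheelPair k α' ρ' →
        ∃ f : TruncCohomology 3 (cone (SimpleGraph.cycleGraph (k + 3))) num 1 j →+ B,
          ∀ i, f (α i) = α' i ∧ f (ρ i) = ρ' i := by
  have h1 : (1 : Fin (k + 3)) ≠ 0 := by simp
  have h2 : (1 + 1 : Fin (k + 3)) ≠ 0 := by
    rw [Ne, Fin.ext_iff, Fin.val_add]
    simp only [Fin.val_one, Fin.val_zero]
    rw [Nat.mod_eq_of_lt (by omega)]
    omega
  have hG : ∀ i k' : Fin (k + 3), (cone (SimpleGraph.cycleGraph (k + 3))).Adj (some i) (some k') ↔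
      k' = i + 1 ∨ i = k' + 1 := by
    intro i k'
    change (SimpleGraph.cycleGraph (k + 1 + 2)).Adj i k' ↔ _
    rw [SimpleGraph.cycleGraph_adj, sub_eq_iff_eq_add, sub_eq_iff_eq_add, add_comm 1, add_comm 1,
      or_comm]
  obtain ⟨g, hg, hgen, huniv⟩ := exists_universal_edgeSystem
    (cone (SimpleGraph.cycleGraph (k + 3))) num (j := j) (by simp; omega)
  -- Everything except the choice of `ρ` is common to both kinds of rim.
  have main : ∀ ρ : Fin (k + 3) → TruncCohomology 3 (cone (SimpleGraph.cycleGraph (k + 3))) num 1 j,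
      (∀ i j, j ≠ i → j ≠ i + 1 → g (some i) (some (i + 1)) (some j) =
        (if j = i + 1 + 1 then ρ (i + 1) else 0) - if i = j + 1 then ρ i else 0) →
      (k = 0 → ρ 0 = 0) →
      (∀ (B : Type) [AddCommGroup B] (α' ρ' : Fin (k + 3) → B)
        (f : TruncCohomology 3 (cone (SimpleGraph.cycleGraph (k + 3))) num 1 j →+ B),
        IsWheelPair k α' ρ' → (∀ u v w, f (g u v w) = wheelSystem 1 α' ρ' u v w) →
          ∀ i, f (ρ i) = ρ' i) →
      ∃ α ρ : Fin (k + 3) → TruncCohomology 3 (cone (SimpleGraph.cycleGraph (k + 3))) num 1 j,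
      IsWheelPair k α ρ ∧ AddSubgroup.closure (Set.range α ∪ Set.range ρ) = ⊤ ∧
      ∀ (B : Type) [AddCommGroup B] (α' ρ' : Fin (k + 3) → B), IsWheelPair k α' ρ' →
        ∃ f : TruncCohomology 3 (cone (SimpleGraph.cycleGraph (k + 3))) num 1 j →+ B,
          ∀ i, f (α i) = α' i ∧ f (ρ i) = ρ' i := by
    intro ρ hρ hρ0 hρf
    have hgw := hg.eq_wheelSystem h1 h2 (fun i k' => (hG i k').1) (fun i => rfl) hρ
    have hg' := hg
    rw [hgw] at hg'
    refine ⟨fun i => ρ (i + 1) - ρ i - g (some i) (some (i + 1)) (some i), ρ,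
      ⟨hg'.three_smul_eq_zero h1 h2, hρ0⟩, ?_, ?_⟩
    · rw [eq_top_iff, ← hgen, AddSubgroup.closure_le]
      rintro _ ⟨u, v, w, rfl⟩
      rw [hgw]
      refine wheelSystem_mem (fun i => ?_) (fun i => ?_) u v w
      · refine AddSubgroup.subset_closure (Or.inl ⟨i, ?_⟩)
        exact congrArg (_ - ·) (congrFun (congrFun (congrFun hgw _) _) _).symm
      · exact AddSubgroup.subset_closure (Or.inr ⟨i, rfl⟩)
    · intro B _ α' ρ' h'
      obtain ⟨f, hf⟩ := huniv B (wheelSystem 1 α' ρ') (isEdgeSystem_wheelSystem h1 h2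
        (fun i => trivial) (fun i k' => (hG i k').2) h'.three_smul)
      refine ⟨f, fun i => ⟨?_, hρf B α' ρ' f h' hf i⟩⟩
      rw [map_sub, map_sub, hρf B α' ρ' f h' hf, hρf B α' ρ' f h' hf, hf,
        wheelSystem_rim_self h1 h2]
      abel
  by_cases hk : k = 0
  · subst hk
    have hc := hg.cyclic (some 0) (some 1) (some 2) (by simp) (by simp) (by simp)
    -- On a triangle the value at the edge `{i, i + 1}` and the opposite vertex is `ρ (i + 1) - ρ
    -- i`. Starting from `ρ 0 = 0` this dictates the vector; the edge `{1, 2}` then agrees by the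
    -- cyclic relation `hc`.
    refine main ![0, g (some 0) (some 1) (some 2), -g (some 2) (some 0) (some 1)] ?_
      (fun _ => rfl) ?_
    · intro i j hij hij'
      fin_cases i <;> fin_cases j <;> simp at hij hij' ⊢
      rw [← sub_eq_zero, ← hc]
      abel
    · intro B _ α' ρ' f h' hf i
      have h0 := h'.zero rfl
      fin_cases i <;> simp [hf, wheelSystem, rimValue, h0]
  · have h3 : (1 + 1 + 1 : Fin (k + 3)) ≠ 0 := by
      rw [Ne, Fin.ext_iff, Fin.val_add, Fin.val_add]
      simp only [Fin.val_one, Fin.val_zero]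
      rw [Nat.mod_eq_of_lt (a := 1 + 1) (by omega), Nat.mod_eq_of_lt (by omega)]
      omega
    refine main (fun i => g (some (i - 1)) (some i) (some (i + 1))) ?_ (fun h => absurd h hk) ?_
    · intro i j hij hij'
      exact hg.rim_path h1 h3 (fun i k' => (hG i k').1) hij hij'
    · intro B _ α' ρ' f _ hf i
      rw [hf, wheelSystem_rim_path h2 h3]

/-! ### Identification of the presented groups -/

section Targets

variable {H : Type*} [AddCommGroup H]

theorem exists_hom_pi_zmod {ι : Type*} [Fintype ι] [DecidableEq ι] (n : ℕ) (x : ι → H)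
    (hx : ∀ i, (n : ℤ) • x i = 0) :
    ∃ ψ : (ι → ZMod n) →+ H, ∀ i, ψ (Pi.single i 1) = x i := by
  let φ : ι → ZMod n →+ H := fun i => ZMod.lift n ⟨zmultiplesHom H (x i), hx i⟩
  have hφ : ∀ i, φ i 1 = x i := by
    intro i
    have h := ZMod.lift_coe n ⟨zmultiplesHom H (x i), hx i⟩ 1
    rw [Int.cast_one] at h
    rw [h]
    simp
  refine ⟨∑ i, (φ i).comp (Pi.evalAddMonoidHom _ i), fun i => ?_⟩
  rw [AddMonoidHom.finsetSum_apply, Finset.sum_eq_single i]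
  · simp [hφ]
  · intro b _ hb
    simp [Pi.single_eq_of_ne hb]
  · simp

theorem exists_hom_pi_int {ι : Type*} [Fintype ι] [DecidableEq ι] (x : ι → H) :
    ∃ ψ : (ι → ℤ) →+ H, ∀ i, ψ (Pi.single i 1) = x i := by
  refine ⟨∑ i, (zmultiplesHom H (x i)).comp (Pi.evalAddMonoidHom _ i), fun i => ?_⟩
  rw [AddMonoidHom.finsetSum_apply, Finset.sum_eq_single i]
  · simp
  · intro b _ hb
    simp [Pi.single_eq_of_ne hb]
  · simp

theorem hom_ext_pi {ι R : Type*} [Finite ι] [DecidableEq ι] [Ring R]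
    (hR : Function.Surjective (Int.cast : ℤ → R)) {f g : (ι → R) →+ H}
    (h : ∀ i, f (Pi.single i 1) = g (Pi.single i 1)) : f = g := by
  refine AddMonoidHom.functions_ext' _ _ _ fun i => ?_
  ext x
  obtain ⟨z, rfl⟩ := hR x
  have hz : (Pi.single i (z : R) : ι → R) = z • Pi.single i (1 : R) := by
    rw [← Pi.single_smul, zsmul_one]
  simp only [AddMonoidHom.comp_apply, AddMonoidHom.single_apply]
  rw [hz, map_zsmul, map_zsmul, h]

/-- A one-sided inverse makes `ψ` injective, and reaching the generators makes it surjective, so the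
second composite never has to be computed. -/
theorem nonempty_addEquiv_of_comp_eq_id {T : Type*} [AddCommGroup T] {S : Set H}
    (hS : AddSubgroup.closure S = ⊤) (f : H →+ T) (ψ : T →+ H)
    (hfψ : f.comp ψ = AddMonoidHom.id T) (hψ : ∀ x ∈ S, x ∈ ψ.range) : Nonempty (H ≃+ T) := by
  refine ⟨(AddEquiv.ofBijective ψ ⟨?_, ?_⟩).symm⟩
  · exact Function.LeftInverse.injective (g := f) fun x => DFunLike.congr_fun hfψ x
  · rw [← AddMonoidHom.range_eq_top, eq_top_iff, ← hS, AddSubgroup.closure_le]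
    exact hψ

/-- The cyclic condition is cut at 0 into a chain, suited to induction, and one closing condition.
-/
theorem forall_sub_one_iff {k : ℕ} {P : Fin (k + 3) → Fin (k + 3) → Prop} :
    (∀ i, P (i - 1) i) ↔ P (Fin.last _) 0 ∧ ∀ i : Fin (k + 2), P i.castSucc i.succ := by
  have h0 : (0 : Fin (k + 3)) - 1 = Fin.last _ := by
    rw [sub_eq_iff_eq_add, Fin.last_add_one]
  have hs : ∀ i : Fin (k + 2), i.succ - 1 = i.castSucc := fun i => by
    rw [sub_eq_iff_eq_add, Fin.coeSucc_eq_succ]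
  constructor
  · intro h
    refine ⟨h0 ▸ h 0, fun i => hs i ▸ h i.succ⟩
  · rintro ⟨h, h'⟩ i
    cases i using Fin.cases with
    | zero => rw [h0]; exact h
    | succ i => rw [hs]; exact h' i

theorem IsWheelPair.three_smul_eq {k : ℕ} {α ρ : Fin (k + 3) → H} (h : IsWheelPair k α ρ)
    (i : Fin (k + 3)) : (3 : ℤ) • α i = (-1 : ℤ) ^ (i : ℕ) • (3 : ℤ) • α 0 := by
  have h' := (forall_sub_one_iff (P := fun i j => (3 : ℤ) • (α i + α j) = 0)).1 h.three_smul
  induction i using Fin.induction with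
  | zero => simp
  | succ i ih =>
    have h2 := h'.2 i
    rw [smul_add] at h2
    rw [eq_neg_of_add_eq_zero_right h2, ih, Fin.val_succ, pow_succ, mul_neg_one, neg_smul,
      Fin.val_castSucc]

theorem three_smul_pi_zmod {ι : Type*} (x : ι → ZMod 3) : (3 : ℤ) • x = 0 := by
  funext i
  have : ((3 : ℤ) : ZMod 3) = 0 := rfl
  rw [Pi.smul_apply, zsmul_eq_mul, this, zero_mul, Pi.zero_apply]

variable {k : ℕ} {α ρ : Fin (k + 3) → H}

/-- The group presented by `IsWheelPair`, for a rim with an odd number of vertices; the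
generators `ρ i` that are not forced to vanish are numbered by `r`. -/
theorem nonempty_addEquiv_of_odd_rim {ι : Type} [Fintype ι] [DecidableEq ι] (hk : Even k)
    (h : IsWheelPair k α ρ) (hgen : AddSubgroup.closure (Set.range α ∪ Set.range ρ) = ⊤)
    (huniv : ∀ (B : Type) [AddCommGroup B] (α' ρ' : Fin (k + 3) → B), IsWheelPair k α' ρ' →
        ∃ f : H →+ B, ∀ i, f (α i) = α' i ∧ f (ρ i) = ρ' i)
    (r : ι → Fin (k + 3)) (hr : Function.Injective r) (hr0 : k = 0 → 0 ∉ Set.range r)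
    (hr' : ∀ i, i ∈ Set.range r ∨ ρ i = 0) :
    Nonempty (H ≃+ (Fin (k + 3) → ZMod 3) × ZMod 2 × (ι → ℤ)) := by
  -- The last index `k + 2` is even, so the closing relation reads `3α_0 + 3α_0 = 0`.
  have h6 : (6 : ℤ) • α 0 = 0 := by
    have h' := (forall_sub_one_iff (P := fun i j => (3 : ℤ) • (α i + α j) = 0)).1 h.three_smul
    have h1 := h'.1
    rw [smul_add, h.three_smul_eq, Fin.val_last, (hk.add even_two).neg_one_pow, one_smul,
      ← add_smul] at h1
    exact h1
  have h3 : ∀ i, (3 : ℤ) • α i = (3 : ℤ) • α 0 := by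
    intro i
    rw [h.three_smul_eq]
    rcases neg_one_pow_eq_or ℤ (i : ℕ) with e | e
    · rw [e, one_smul]
    · rw [e, neg_one_smul, neg_eq_iff_add_eq_zero, ← add_smul]
      exact h6
  -- Since 4 is 1 modulo 3 and 0 modulo 2, `4α_i` is the 3-primary part of `α_i`; the 2-primary part
  -- is `3α_i = 3α_0`, the same for all `i`.
  obtain ⟨ψ1, hψ1⟩ := exists_hom_pi_zmod 3 (fun i => (4 : ℤ) • α i) (fun i => by
    rw [smul_comm, Nat.cast_ofNat, h3, smul_smul, show (4 * 3 : ℤ) = 2 * 6 by norm_num, mul_smul,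
      h6, smul_zero])
  obtain ⟨ψ2, hψ2⟩ : ∃ ψ : ZMod 2 →+ H, ψ 1 = (3 : ℤ) • α 0 := by
    refine ⟨ZMod.lift 2 ⟨zmultiplesHom H ((3 : ℤ) • α 0), ?_⟩, ?_⟩
    · rw [zmultiplesHom_apply, smul_smul]
      exact h6
    · rw [← Int.cast_one, ZMod.lift_coe]
      simp
  obtain ⟨ψ3, hψ3⟩ := exists_hom_pi_int fun i => ρ (r i)
  let α' : Fin (k + 3) → (Fin (k + 3) → ZMod 3) × ZMod 2 × (ι → ℤ) := fun i => (Pi.single i 1, 1, 0)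
  let ρ' : Fin (k + 3) → (Fin (k + 3) → ZMod 3) × ZMod 2 × (ι → ℤ) :=
    fun i => (0, 0, fun x => if r x = i then 1 else 0)
  obtain ⟨f, hf⟩ := huniv _ α' ρ' ⟨fun i => by
      refine Prod.ext (three_smul_pi_zmod _) (Prod.ext rfl ?_)
      simp [α'], fun hk0 => by
      refine Prod.ext rfl (Prod.ext rfl (funext fun x => if_neg fun hx => hr0 hk0 ⟨x, hx⟩))⟩
  refine nonempty_addEquiv_of_comp_eq_id hgen f (ψ1.coprod (ψ2.coprod ψ3)) ?_ ?_
  · refine AddMonoidHom.ext fun ⟨x, y, z⟩ => ?_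
    have e1 : f.comp ψ1 = AddMonoidHom.inl _ _ := by
      refine hom_ext_pi ZMod.intCast_surjective fun i => ?_
      rw [AddMonoidHom.comp_apply, hψ1, map_zsmul, (hf i).1, AddMonoidHom.inl_apply]
      refine Prod.ext ?_ (Prod.ext rfl (by simp [α']))
      rw [show (4 : ℤ) = 3 + 1 by norm_num, add_smul, one_smul, Prod.fst_add]
      change (3 : ℤ) • (α' i).1 + _ = _
      rw [three_smul_pi_zmod, zero_add]
    have e2 : f.comp ψ2 = (AddMonoidHom.inr _ _).comp (AddMonoidHom.inl _ _) := by
      refine AddMonoidHom.ext fun y => ?_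
      obtain ⟨z, rfl⟩ := ZMod.intCast_surjective y
      rw [← zsmul_one, map_zsmul, map_zsmul, AddMonoidHom.comp_apply, hψ2, map_zsmul, (hf 0).1]
      congr 1
      exact Prod.ext (three_smul_pi_zmod _) (Prod.ext rfl (by simp [α']))
    have e3 : f.comp ψ3 = (AddMonoidHom.inr _ _).comp (AddMonoidHom.inr _ _) := by
      refine hom_ext_pi (fun z => ⟨z, rfl⟩) fun i => ?_
      rw [AddMonoidHom.comp_apply, hψ3, (hf _).2]
      refine Prod.ext rfl (Prod.ext rfl (funext fun x => ?_))
      simp [ρ', hr.eq_iff, Pi.single_apply]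
    have e1' := DFunLike.congr_fun e1 x
    have e2' := DFunLike.congr_fun e2 y
    have e3' := DFunLike.congr_fun e3 z
    simp only [AddMonoidHom.comp_apply] at e1' e2' e3'
    simp [e1', e2', e3']
  · rintro _ (⟨i, rfl⟩ | ⟨i, rfl⟩)
    · refine ⟨(Pi.single i 1, 1, 0), ?_⟩
      simp only [AddMonoidHom.coprod_apply, map_zero, add_zero, hψ1, hψ2]
      -- Here `4α_i + 3α_0 = 7α_i = α_i`, as `6α_i = 0`.
      rw [← h3 i, ← add_smul, show (4 + 3 : ℤ) = 1 + 6 by norm_num, add_smul, one_smul,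
        show (6 : ℤ) = 2 * 3 by norm_num, mul_smul, h3, smul_smul, show (2 * 3 : ℤ) = 6 by norm_num,
        h6, add_zero]
    · rcases hr' i with ⟨x, rfl⟩ | h0
      · refine ⟨(0, 0, Pi.single x 1), ?_⟩
        simp [hψ3]
      · rw [h0]
        exact AddSubgroup.zero_mem _

/-- The group presented by `IsWheelPair`, for a rim with an even number of vertices. -/
theorem nonempty_addEquiv_of_even_rim (hk : Odd k)
    (h : IsWheelPair k α ρ) (hgen : AddSubgroup.closure (Set.range α ∪ Set.range ρ) = ⊤)
    (huniv : ∀ (B : Type) [AddCommGroup B] (α' ρ' : Fin (k + 3) → B), IsWheelPair k α' ρ' →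
        ∃ f : H →+ B, ∀ i, f (α i) = α' i ∧ f (ρ i) = ρ' i) :
    Nonempty (H ≃+ (Fin (k + 2) → ZMod 3) × (Fin (k + 4) → ℤ)) := by
  have hsq : ∀ n : ℕ, (-1 : ℤ) ^ n * (-1) ^ n = 1 := fun n => by
    rw [← mul_pow, neg_one_mul, neg_neg, one_pow]
  -- After the alternating sign, all `α_i` have the same triple, so their differences from `α_0` are
  -- 3-torsion.
  obtain ⟨ψ1, hψ1⟩ := exists_hom_pi_zmod 3
    (fun i : Fin (k + 2) => (-1 : ℤ) ^ (i.succ : ℕ) • α i.succ - α 0) (fun i => by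
      rw [smul_sub, smul_comm, Nat.cast_ofNat, h.three_smul_eq, smul_smul, hsq, one_smul, sub_self])
  obtain ⟨ψ2, hψ2⟩ := exists_hom_pi_int (Fin.cons (α 0) ρ : Fin (k + 4) → H)
  -- The torsion coordinates measure differences from `α_0`, so `α_0` itself has none.
  let ε : Fin (k + 3) → Fin (k + 2) → ZMod 3 := Fin.cons 0 fun i => Pi.single i 1
  let α' : Fin (k + 3) → (Fin (k + 2) → ZMod 3) × (Fin (k + 4) → ℤ) :=
    fun i => (-1 : ℤ) ^ (i : ℕ) • (ε i, Pi.single 0 1)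
  let ρ' : Fin (k + 3) → (Fin (k + 2) → ZMod 3) × (Fin (k + 4) → ℤ) :=
    fun i => (0, Pi.single i.succ 1)
  obtain ⟨f, hf⟩ := huniv _ α' ρ' ⟨by
      refine (forall_sub_one_iff (P := fun i j => (3 : ℤ) • (α' i + α' j) = 0)).2 ⟨?_, fun i => ?_⟩
      · refine Prod.ext (three_smul_pi_zmod _) ?_
        have : Odd (k + 2) := hk.add_even even_two
        simp [α', this.neg_one_pow]
      · refine Prod.ext (three_smul_pi_zmod _) ?_
        simp [α', pow_succ], fun hk0 => by
      subst hk0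
      simp at hk⟩
  refine nonempty_addEquiv_of_comp_eq_id hgen f (ψ1.coprod ψ2) ?_ ?_
  · refine AddMonoidHom.ext fun ⟨x, y⟩ => ?_
    have e1 : f.comp ψ1 = AddMonoidHom.inl _ _ := by
      refine hom_ext_pi ZMod.intCast_surjective fun i => ?_
      rw [AddMonoidHom.comp_apply, hψ1, map_sub, map_zsmul, (hf _).1, (hf _).1]
      simp only [α']
      rw [smul_smul, hsq, one_smul]
      simp [ε]
    have e2 : f.comp ψ2 = AddMonoidHom.inr _ _ := by
      refine hom_ext_pi (fun z => ⟨z, rfl⟩) fun i => ?_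
      rw [AddMonoidHom.comp_apply, hψ2]
      cases i using Fin.cases with
      | zero =>
        rw [Fin.cons_zero, (hf _).1]
        simp [α', ε]
      | succ i =>
        rw [Fin.cons_succ, (hf _).2]
        rfl
    have e1' := DFunLike.congr_fun e1 x
    have e2' := DFunLike.congr_fun e2 y
    simp only [AddMonoidHom.comp_apply] at e1' e2'
    simp [e1', e2']
  · have h0 : α 0 ∈ (ψ1.coprod ψ2).range := ⟨(0, Pi.single 0 1), by simp [hψ2]⟩
    rintro _ (⟨i, rfl⟩ | ⟨i, rfl⟩)
    · cases i using Fin.cases with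
      | zero => exact h0
      | succ i =>
        have h1 : (-1 : ℤ) ^ (i.succ : ℕ) • α i.succ - α 0 ∈ (ψ1.coprod ψ2).range :=
          ⟨(Pi.single i 1, 0), by simp [hψ1]⟩
        have h2 := AddSubgroup.zsmul_mem _ (AddSubgroup.add_mem _ h1 h0) ((-1 : ℤ) ^ (i.succ : ℕ))
        rwa [sub_add_cancel, smul_smul, hsq, one_smul] at h2
    · exact ⟨(0, Pi.single i.succ 1), by simp [hψ2]⟩

end Targets

end ChromaticCohomology

theorem corollary4p11 (n : ℕ) (hn : 4 ≤ n)
    (num : (ChromaticCohomology.wheel n).edgeSet ↪ ℕ) :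
    (Odd n →
      Nonempty (ChromaticCohomology.TruncCohomology 3 (ChromaticCohomology.wheel n) num 1
        (2 * n - 3) ≃+ (Fin (n - 2) → ZMod 3) × (Fin n → ℤ))) ∧
    (Even n → 6 ≤ n →
      Nonempty (ChromaticCohomology.TruncCohomology 3 (ChromaticCohomology.wheel n) num 1
        (2 * n - 3) ≃+ (Fin (n - 1) → ZMod 3) × ZMod 2 × (Fin (n - 1) → ℤ))) ∧
    (n = 4 →
      Nonempty (ChromaticCohomology.TruncCohomology 3 (ChromaticCohomology.wheel n) num 1
        (2 * n - 3) ≃+ (Fin 3 → ZMod 3) × ZMod 2 × (Fin 2 → ℤ))) := by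
  -- With `n = k + 4` the rim has `k + 3` vertices, so its parity is opposite to that of `n`.
  obtain ⟨k, rfl⟩ := Nat.exists_eq_add_of_le' hn
  obtain ⟨α, ρ, h, hgen, huniv⟩ := ChromaticCohomology.exists_wheelPair k num
    (j := 2 * (k + 4) - 3) (by omega)
  refine ⟨fun hodd => ?_, fun heven h6 => ?_, fun h4 => ?_⟩
  · refine ChromaticCohomology.nonempty_addEquiv_of_even_rim ?_ h hgen huniv
    rcases hodd with ⟨l, hl⟩
    exact ⟨l - 2, by omega⟩
  · refine ChromaticCohomology.nonempty_addEquiv_of_odd_rim ?_ h hgen huniv id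
      Function.injective_id (fun h0 => by omega) fun i => Or.inl ⟨i, rfl⟩
    rcases heven with ⟨l, hl⟩
    exact ⟨l - 2, by omega⟩
  · obtain rfl : k = 0 := by omega
    -- On the triangular rim `ρ 0` vanishes, and `Fin.succ` numbers the two free generators that
    -- remain.
    refine ChromaticCohomology.nonempty_addEquiv_of_odd_rim (by simp) h hgen huniv Fin.succ
      (Fin.succ_injective 2) (fun _ => ?_) fun i => ?_
    · rintro ⟨i, hi⟩
      exact Fin.succ_ne_zero i hi
    · cases i using Fin.cases with
      | zero => exact Or.inr (h.zero rfl)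
      | succ i => exact Or.inl ⟨i, rfl⟩
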